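/- \textbf{Definitions.} Let $G$ be a group. A \emph{chain} in $G$ is an element of the real vector space $C_1(G)$ with basis $G$; it is \emph{integral} if its coefficients are integers. Let $E(G)\subseteq C_1(G)$ be the real subspace spanned by the chains $g^n-n\cdot g$ ($g\in G$, $n\in\mathbb Z$), $hgh^{-1}-g$ ($g,h\in G$), and $gh-g-h$ ($g,h\in G$ commuting). Two chains are \emph{equivalent} if they differ by an element of $E(G)$. Let $X$ be a path-connected space with $\pi_1(X)=G$. For an integral chain $c=\sum_j n_j g_j$ with distinct $g_j\in G$ and nonzero $n_j \in \mathbb Z$, choose loops $\gamma_j$ in $X$ representing the conjugacy classes of the $g_j$. An \emph{admissible surface} of degree $n(S,f)>0$ for $c$ is a map $f:S\to X$ from a compact oriented surface whose restriction to the boundary factors through $\sqcup_j\gamma_j:\sqcup_j S^1_j\to X$ by a map $\partial f$ with $\partial f_*[\partial S]=n(S,f)\sum_j n_j[S^1_j]$. Then $$\mathrm{scl}_G(c)=\inf_{(S,f)}\frac{-\chi^-(S)}{2\,n(S,f)},$$ where $\chi^-(S)$ is the Euler characteristic of $S$ after removing disk and sphere components; $\mathrm{scl}_G(c)=+\infty$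 if there is no admissible surface, that is, if $c$ is nonzero in $H_1(G;\mathbb Q)$. For $H\le G$, an element $g\in G$ is a \emph{CM-representative} for $H$ if for every $h\in H$ either $ghg^{-1}=h$ or $ghg^{-1}\notin H$. The subgroup $H$ is a \emph{CM-subgroup} of $G$ if every double coset $HgH$, $g\in G$, contains a CM-representative for $H$. A \emph{CM-subgroup sequence of length $m+1$} in $G$ ($m \ge 0$) is a sequence of subgroups $G=H_0>H_1>\cdots>H_{m+1}\ge H_{m+2}$ such that for all $0\le i\le m$ the group $H_{i+1}$ is a proper CM-subgroup of $H_i$ and $H_{i+2}=Z_{H_{i+1}}(g_i)$ is the centralizer in $H_{i+1}$ of some CM-representative $g_i\in H_i\setminus H_{i+1}$ for $H_{i+1}$. For an integer $D\ge 0$, a subgroup $C\le G$ is \emph{BCMS-$D$} if it is a CM-subgroup of $G$ and every CM-subgroup sequence $H_{m+2}\le\cdots\le H_0$ with $H_0=G$ and $H_1=C$ satisfies $m\le D$ and either $H_{m+2}=H_{m+1}$ or $H_{m+2}$ is a proper CM-subgroup of $H_{m+1}$. \textbf{Theorem.} Let $D\ge 0$ be an integer and let $G$ be the fundamental group of a graph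 of groups (over a nonempty connected graph, possibly infinite) such that every edge group, embedded in $G$ (which is well defined up to conjugation), is a BCMS-$D$ subgroup of $G$. Let $c$ be an integral chain in $G$. Then either $c$ is equivalent to an integral chain $\tilde c$ all of whose terms lie in (conjugates of) vertex groups, or $$\mathrm{scl}_G(c)\ge\frac{1}{12(D+2)}.$$ -/

import Mathlib

open scoped ENNReal

universe u v w x

/-! ### Chains and their equivalence -/

/-- Integral chains in `G`: finite formal sums of elements of `G` with integer coefficients. -/
abbrev IntegralChain (G : Type u) : Type u := G →₀ ℤ

/-- The space `C₁(G)` of real `1`-chains. -/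
abbrev RealChain (G : Type u) : Type u := G →₀ ℝ

/-- An integral chain regarded as a real chain. -/
noncomputable def IntegralChain.toReal {G : Type u} (c : IntegralChain G) : RealChain G :=
  c.mapRange (fun n : ℤ => (n : ℝ)) (by simp)

/-- The real subspace `E(G)` of `C₁(G)` spanned by the chains `gⁿ - n·g` with `n ∈ ℤ`, the chains
`h g h⁻¹ - g`, and the chains `g h - g - h` for commuting `g` and `h`. -/
noncomputable def chainRelations (G : Type u) [Group G] : Submodule ℝ (RealChain G) :=
  Submodule.span ℝ
    ({z | ∃ (g : G) (n : ℤ), z = Finsupp.single (g ^ n) 1 - (n : ℝ) • Finsupp.single g 1} ∪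
     {z | ∃ g h : G, z = Finsupp.single (h * g * h⁻¹) 1 - Finsupp.single g 1} ∪
     {z | ∃ g h : G, Commute g h ∧
        z = Finsupp.single (g * h) 1 - Finsupp.single g 1 - Finsupp.single h 1})

/-- Two chains are equivalent if they differ by an element of `E(G)`. -/
def ChainEquiv {G : Type u} [Group G] (c c' : RealChain G) : Prop :=
  c - c' ∈ chainRelations G

/-! ### Stable commutator length

Let `X` be a path-connected space with `π₁(X) = G`. A map from a compact connected oriented
surface with given genus and given boundary components to `X` is recorded, up to homotopy, by a
homomorphism from `π₁` of the surface to `G`, that is, by the images of the standard generators.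
The restriction of the map to a boundary component factors through a loop representing an
element `g` of `G`, with some winding number. -/

/-- A boundary component of a surface mapped to a space with fundamental group `G`: it winds
`winding` times around the loop that represents `loop`, and it is joined to the base point of the
surface by an arc that represents `arc`. -/
structure BoundaryCurve (G : Type u) where
  arc : G
  loop : G
  winding : ℤ

/-- The element of `G` represented by a boundary component. -/
def BoundaryCurve.elem {G : Type u} [Group G] (b : BoundaryCurve G) : G :=
  b.arc * b.loop ^ b.winding * b.arc⁻¹

/-- A compact connected oriented surface together with a map to a space with fundamental group
`G`: the images of the handle generators and of the boundary components, subject to the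
relation `[a₁, b₁] ⋯ [aₛ, bₛ] z₁ ⋯ zₚ = 1` of the standard presentation of the fundamental group of
the surface of genus `s` with `p` boundary components. -/
structure MappedSurface (G : Type u) [Group G] where
  handles : List (G × G)
  boundary : List (BoundaryCurve G)
  relation : (handles.map fun h => h.1 * h.2 * h.1⁻¹ * h.2⁻¹).prod *
      (boundary.map BoundaryCurve.elem).prod = 1

/-- `-χ⁻` of a connected surface of genus `s` with `p` boundary components: it is `2 s + p - 2`,
except that spheres and disks (the only surfaces with `2 s + p - 2 < 0`) count `0`. The truncated
subtraction of natural numbers is intended. -/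
def MappedSurface.complexity {G : Type u} [Group G] (S : MappedSurface G) : ℕ :=
  2 * S.handles.length + S.boundary.length - 2

/-- The integral chain `∑ (winding) · (loop)`, which records `∂f_*[∂S]`. -/
noncomputable def MappedSurface.boundaryChain {G : Type u} [Group G] (S : MappedSurface G) :
    IntegralChain G :=
  (S.boundary.map fun b => Finsupp.single b.loop b.winding).sum

/-- `S`, a list of connected components, is an admissible surface of degree `n > 0` for the
integral chain `c`: its boundary maps to the loops which occur in `c`, and the total winding number
around the loop of `g` is `n` times the coefficient of `g` in `c`. -/
def IsAdmissible {G : Type u} [Group G] (c : IntegralChain G) (S : List (MappedSurface G))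
    (n : ℕ) : Prop :=
  0 < n ∧ (∀ T ∈ S, ∀ b ∈ T.boundary, b.loop ∈ c.support) ∧
    (S.map MappedSurface.boundaryChain).sum = n • c

/-- Stable commutator length of an integral chain: the infimum of `-χ⁻(S) / (2 n)` over all
admissible surfaces `S`, where `n` is the degree of `S`. It is `∞` if there are no admissible
surfaces, that is, if `c` represents a nontrivial class in `H₁(G; ℚ)`. -/
noncomputable def scl {G : Type u} [Group G] (c : IntegralChain G) : ℝ≥0∞ :=
  ⨅ (S : List (MappedSurface G)) (n : ℕ) (_ : IsAdmissible c S n),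
    (((S.map MappedSurface.complexity).sum : ℕ) : ℝ≥0∞) / (2 * (n : ℝ≥0∞))

/-! ### Central/malnormal subgroups -/

/-- `g` is a CM-representative for `H`: for every `h ∈ H`, the element `g h g⁻¹` is equal to `h`
or lies outside `H`. -/
def IsCMRep {G : Type u} [Group G] (H : Subgroup G) (g : G) : Prop :=
  ∀ h ∈ H, g * h * g⁻¹ = h ∨ g * h * g⁻¹ ∉ H

/-- `K` is a CM-subgroup of `H`, for subgroups `K` and `H` of an ambient group: `K ≤ H`, and for
every `g ∈ H` the double coset `K g K` contains a CM-representative for `K`. -/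
def IsCMSubgroup {G : Type u} [Group G] (K H : Subgroup G) : Prop :=
  K ≤ H ∧ ∀ g ∈ H, ∃ a ∈ K, ∃ b ∈ K, IsCMRep K (a * g * b)

/-- A CM-subgroup sequence `G = H₀ > H₁ > ⋯ > H_{m+1} ≥ H_{m+2}` of length `m + 1` in `G`: for all
`0 ≤ i ≤ m`, the group `H_{i+1}` is a proper CM-subgroup of `H_i`, and `H_{i+2}` is the centralizer
in `H_{i+1}` of a CM-representative `g_i ∈ H_i \ H_{i+1}` for `H_{i+1}`. (The values of `H` beyond
`m + 2` play no role.) -/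
def IsCMSequence {G : Type u} [Group G] (m : ℕ) (H : ℕ → Subgroup G) : Prop :=
  H 0 = ⊤ ∧ ∀ i ≤ m, H (i + 1) < H i ∧ IsCMSubgroup (H (i + 1)) (H i) ∧
    ∃ g ∈ H i, g ∉ H (i + 1) ∧ IsCMRep (H (i + 1)) g ∧
      H (i + 2) = H (i + 1) ⊓ Subgroup.centralizer {g}

/-- `C ≤ G` has bounded CM-subgroup sequences of depth `D`: `C` is a CM-subgroup of `G`, and for
every CM-subgroup sequence of length `m + 1` with `H₀ = G` and `H₁ = C`, the last group `H_{m+2}` is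
equal to `H_{m+1}` or a proper CM-subgroup of it, and `m ≤ D`. -/
def IsBCMS {G : Type u} [Group G] (D : ℕ) (C : Subgroup G) : Prop :=
  IsCMSubgroup C ⊤ ∧ ∀ (m : ℕ) (H : ℕ → Subgroup G), IsCMSequence m H → H 1 = C →
    (H (m + 2) = H (m + 1) ∨ (H (m + 2) < H (m + 1) ∧ IsCMSubgroup (H (m + 2)) (H (m + 1)))) ∧
      m ≤ D

/-! ### Graphs of groups -/

/-- A graph of groups: a nonempty connected graph, possibly infinite, with loops and multiple edges
allowed, in which an orientation of each edge has been chosen, with a group for every vertex and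
every edge, and injections of every edge group into the groups of the two end points. -/
structure GraphOfGroups where
  V : Type u
  E : Type v
  src : E → V
  tgt : E → V
  nonempty : Nonempty V
  connected : ∀ a b : V, Relation.EqvGen (fun a b => ∃ e, src e = a ∧ tgt e = b) a b
  vertexGroup : V → Type w
  edgeGroup : E → Type x
  vertexGroupInst : ∀ a, Group (vertexGroup a)
  edgeGroupInst : ∀ e, Group (edgeGroup e)
  toSrc : ∀ e, edgeGroup e →* vertexGroup (src e)
  toTgt : ∀ e, edgeGroup e →* vertexGroup (tgt e)
  toSrc_injective : ∀ e, Function.Injective (toSrc e)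
  toTgt_injective : ∀ e, Function.Injective (toTgt e)

namespace GraphOfGroups

attribute [instance] GraphOfGroups.vertexGroupInst GraphOfGroups.edgeGroupInst

/-- The free product of all the vertex groups and of the free group on the edges. -/
abbrev WordGroup (𝒢 : GraphOfGroups.{u, v, w, x}) : Type (max (max u w) v) :=
  Monoid.Coprod (Monoid.CoprodI 𝒢.vertexGroup) (FreeGroup 𝒢.E)

/-- The relators of the path group: the word `e · a_tgt · e⁻¹ · a_src⁻¹`, for every edge `e` and every
element `a` of its edge group, where `a_src` and `a_tgt` are the images of `a` in the vertex groups. -/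
def relators (𝒢 : GraphOfGroups.{u, v, w, x}) : Set 𝒢.WordGroup :=
  {r | ∃ (e : 𝒢.E) (a : 𝒢.edgeGroup e),
    r = Monoid.Coprod.inr (FreeGroup.of e) *
        Monoid.Coprod.inl (Monoid.CoprodI.of (𝒢.toTgt e a)) *
        (Monoid.Coprod.inr (FreeGroup.of e))⁻¹ *
        (Monoid.Coprod.inl (Monoid.CoprodI.of (𝒢.toSrc e a)))⁻¹}

/-- The path group `F(𝒢)` of a graph of groups. -/
abbrev PathGroup (𝒢 : GraphOfGroups.{u, v, w, x}) : Type (max (max u w) v) :=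
  𝒢.WordGroup ⧸ Subgroup.normalClosure 𝒢.relators

/-- The canonical homomorphism from a vertex group to the path group. -/
def ofVertex (𝒢 : GraphOfGroups.{u, v, w, x}) (a : 𝒢.V) : 𝒢.vertexGroup a →* 𝒢.PathGroup :=
  (QuotientGroup.mk' (Subgroup.normalClosure 𝒢.relators)).comp
    (Monoid.Coprod.inl.comp Monoid.CoprodI.of)

/-- The element of the path group given by an edge. -/
def ofEdge (𝒢 : GraphOfGroups.{u, v, w, x}) (e : 𝒢.E) : 𝒢.PathGroup :=
  QuotientGroup.mk' (Subgroup.normalClosure 𝒢.relators) (Monoid.Coprod.inr (FreeGroup.of e))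

/-- `𝒢.IsPath a b p`: the element `p` of the path group is represented by a word
`g₀ e₁ g₁ ⋯ eₙ gₙ` along a path from the vertex `a` to the vertex `b`, where the edges may be
crossed in both directions and each `gᵢ` belongs to the group of the vertex visited. -/
inductive IsPath (𝒢 : GraphOfGroups.{u, v, w, x}) : 𝒢.V → 𝒢.V → 𝒢.PathGroup → Prop
  | vertex (a : 𝒢.V) (g : 𝒢.vertexGroup a) : IsPath 𝒢 a a (𝒢.ofVertex a g)
  | edge (e : 𝒢.E) : IsPath 𝒢 (𝒢.src e) (𝒢.tgt e) (𝒢.ofEdge e)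
  | edgeInv (e : 𝒢.E) : IsPath 𝒢 (𝒢.tgt e) (𝒢.src e) (𝒢.ofEdge e)⁻¹
  | comp {a b c : 𝒢.V} {p q : 𝒢.PathGroup} :
      IsPath 𝒢 a b p → IsPath 𝒢 b c q → IsPath 𝒢 a c (p * q)

theorem IsPath.inv {𝒢 : GraphOfGroups.{u, v, w, x}} {a b : 𝒢.V} {p : 𝒢.PathGroup}
    (h : 𝒢.IsPath a b p) : 𝒢.IsPath b a p⁻¹ := by
  induction h with
  | vertex a g => rw [← map_inv]; exact .vertex a g⁻¹
  | edge e => exact .edgeInv e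
  | edgeInv e => rw [inv_inv]; exact .edge e
  | comp _ _ ih₁ ih₂ => rw [mul_inv_rev]; exact ih₂.comp ih₁

/-- The fundamental group `π₁(𝒢, a)` of a graph of groups with base vertex `a`: the elements of the
path group represented by closed paths at `a`. -/
def fundamentalGroup (𝒢 : GraphOfGroups.{u, v, w, x}) (a : 𝒢.V) : Subgroup 𝒢.PathGroup where
  carrier := {p | 𝒢.IsPath a a p}
  one_mem' := by
    have h := IsPath.vertex (𝒢 := 𝒢) a 1
    rwa [map_one] at h
  mul_mem' := fun hp hq => IsPath.comp hp hq
  inv_mem' := fun hp => IsPath.inv hp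

/-- The embedding `g ↦ p g p⁻¹` of the group of the vertex `b` into `π₁(𝒢, a)` determined by a path
`p` from `a` to `b`. A different path changes it by a conjugation in `π₁(𝒢, a)`. -/
def vertexEmbedding (𝒢 : GraphOfGroups.{u, v, w, x}) {a b : 𝒢.V} (p : 𝒢.PathGroup)
    (hp : 𝒢.IsPath a b p) : 𝒢.vertexGroup b →* 𝒢.fundamentalGroup a where
  toFun g := ⟨p * 𝒢.ofVertex b g * p⁻¹, (hp.comp (.vertex b g)).comp hp.inv⟩
  map_one' := by ext; simp
  map_mul' g h := by ext; simp [mul_assoc]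

/-- The embedding of the group of the edge `e` into `π₁(𝒢, a)` determined by a path `p` from `a` to
the terminus of `e`. A different path changes it by a conjugation in `π₁(𝒢, a)`, and so does
the use of the origin of `e` in place of its terminus. -/
def edgeEmbedding (𝒢 : GraphOfGroups.{u, v, w, x}) {a : 𝒢.V} (e : 𝒢.E) (p : 𝒢.PathGroup)
    (hp : 𝒢.IsPath a (𝒢.tgt e) p) : 𝒢.edgeGroup e →* 𝒢.fundamentalGroup a :=
  (𝒢.vertexEmbedding p hp).comp (𝒢.toTgt e)

/-- The element `g` of `π₁(𝒢, a)` lies in a vertex group (vertex groups being subgroups of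
`π₁(𝒢, a)` up to conjugation). -/
def InVertexGroup (𝒢 : GraphOfGroups.{u, v, w, x}) {a : 𝒢.V} (g : 𝒢.fundamentalGroup a) : Prop :=
  ∃ (b : 𝒢.V) (p : 𝒢.PathGroup) (hp : 𝒢.IsPath a b p), g ∈ (𝒢.vertexEmbedding p hp).range

end GraphOfGroups

/-!
The fundamental group `G` acts without inversions on the Bass–Serre tree. Vertex stabilizers are
conjugates of vertex groups, and edge stabilizers are conjugates of edge groups, hence BCMS-`D`.
The theorem is a statement about such actions (`IsTreeAction.mem_chainSpan_or_le_scl`), proved with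
quasimorphisms.

*Lower bounds.* A homogeneous quasimorphism `h` of defect at most `6` vanishes on `E(G)` and
satisfies `|h(c)| ≤ 12 scl(c)`, by the surface relation (`IsHomogeneousQuasimorphism.le_scl`). Given
a segment `γ` of the tree, the number of disjoint translates of `γ` on the geodesic from `x` to
`g x`, minus that on the geodesic from `g x` to `x`, is an antisymmetric quasimorphism of defect `3`,
because geodesic triangles are tripods; its homogenization has defect at most `6`
(`IsTreeAction.exists_countingQuasimorphism`).

*Choice of the segment.* Elements without fixed points translate a line. Up to elements with fixed
points, `c` is equivalent to a sum `∑ nᵢ gᵢ` of such elements; take one with the fewest possible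
terms, let `g` be the term of the largest translation length `τ`, and let `γ` be a segment of length
`(D + 2) τ` on its axis. If translates of `γ` and of its inverse do not occur on the axes of the
other terms, and the inverse does not occur on the axis of `g`, then `h` vanishes on the other terms,
and `h(g) ≥ 1 / (D + 2)`, which gives the bound (`le_scl_of_no_overlap`).

*Long overlaps.* The BCMS condition says that `g = t c`, where `c` fixes an edge of the axis, and `t`
commutes with `c` and with the common stabilizer of the edges `e, g e, …, g^D e`
(`IsBCMS.exists_eq_mul`): one writes `g`, up to conjugacy, as a product of CM-representatives along
a CM-subgroup sequence. So the stabilizer of `D + 1` such edges fixes the axis of `g` pointwise, and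
`g` may be replaced by `t`, which is central over this stabilizer. If a translate of `γ` lies on the
axis of another term `x`, then the commutator of `g` and (a conjugate of) `x` fixes enough edges to
fix the axis, so `x` translates the axis of `g`, and both are powers of one element up to factors
with fixed points (`IsCentralAxis.exists_common_root_of_overlap`). If the inverse of `γ` lies on the
axis of `g`, then `g` is a product of two reflections of this axis, and is equivalent to the
difference of two elements with fixed points (`IsCentralAxis.chainClass_eq_of_reflect`). In both
cases the number of terms drops.

*The tree.* The path group acts on the reduced words of the multiple HNN extension whose base is the
product of all the vertex groups (`GraphOfGroups.pathHom`). The words form a tree in which a word is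
joined with its prefix, and the Bass–Serre tree is the subtree of the words given by paths from the
base vertex.
-/

/-! ### Homogeneous quasimorphisms -/

/-- An antisymmetric quasimorphism of defect at most `D`. -/
structure IsAntisymmQuasimorphism {G : Type*} [Group G] (f : G → ℝ) (D : ℝ) : Prop where
  map_inv : ∀ g, f g⁻¹ = -f g
  defect : ∀ g h, |f (g * h) - f g - f h| ≤ D

/-- A homogeneous quasimorphism of defect at most `D`. -/
structure IsHomogeneousQuasimorphism {G : Type*} [Group G] (f : G → ℝ) (D : ℝ) : Prop where
  map_zpow : ∀ g (n : ℤ), f (g ^ n) = n * f g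
  defect : ∀ g h, |f (g * h) - f g - f h| ≤ D

theorem eq_zero_of_forall_nat_mul_abs_le {x C : ℝ} (h : ∀ n : ℕ, n * |x| ≤ C) : x = 0 := by
  by_contra hx
  obtain ⟨n, hn⟩ := exists_nat_gt (C / |x|)
  rw [div_lt_iff₀ (abs_pos.2 hx)] at hn
  exact absurd (h n) (not_le.2 hn)

namespace IsHomogeneousQuasimorphism

variable {G : Type*} [Group G] {f : G → ℝ} {D : ℝ} (hf : IsHomogeneousQuasimorphism f D)
include hf

theorem map_pow (g : G) (n : ℕ) : f (g ^ n) = n * f g := by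
  simpa using hf.map_zpow g n

theorem map_one : f 1 = 0 := by simpa using hf.map_zpow 1 0

theorem map_inv (g : G) : f g⁻¹ = -f g := by simpa using hf.map_zpow g (-1)

theorem nonneg : 0 ≤ D := (abs_nonneg _).trans (hf.defect 1 1)

theorem map_conj (g h : G) : f (h * g * h⁻¹) = f g := by
  rw [← sub_eq_zero]
  refine eq_zero_of_forall_nat_mul_abs_le (C := 2 * D) fun n => ?_
  have h1 := hf.defect (h * g ^ n) h⁻¹
  have h2 := hf.defect h (g ^ n)
  rw [← conj_pow, hf.map_pow, hf.map_inv] at h1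
  rw [hf.map_pow] at h2
  rw [← abs_of_nonneg (Nat.cast_nonneg (α := ℝ) n), ← abs_mul]
  rw [abs_le] at *
  constructor <;> linarith [h1.1, h1.2, h2.1, h2.2]

theorem map_mul_of_commute {g h : G} (hgh : Commute g h) : f (g * h) = f g + f h := by
  rw [← sub_eq_zero]
  refine eq_zero_of_forall_nat_mul_abs_le (C := D) fun n => ?_
  have h1 := hf.defect (g ^ n) (h ^ n)
  rw [← hgh.mul_pow, hf.map_pow, hf.map_pow, hf.map_pow] at h1
  rw [← abs_of_nonneg (Nat.cast_nonneg (α := ℝ) n), ← abs_mul]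
  rwa [mul_sub, mul_add, ← sub_sub]

theorem abs_map_commutator_le (g h : G) : |f (g * h * g⁻¹ * h⁻¹)| ≤ D := by
  have h1 := hf.defect (g * h * g⁻¹) h⁻¹
  rwa [hf.map_conj, hf.map_inv, sub_neg_eq_add, sub_add_cancel] at h1

theorem abs_map_list_prod_sub_sum_le (l : List G) :
    |f l.prod - (l.map f).sum| ≤ D * (l.length - 1 : ℕ) := by
  induction l with
  | nil => simp [hf.map_one]
  | cons a l ih =>
    rcases l with _ | ⟨b, l⟩
    · simp
    · have h1 := hf.defect a (b :: l).prod
      rw [List.prod_cons, List.map_cons, List.sum_cons]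
      simp only [List.length_cons, Nat.add_sub_cancel] at ih ⊢
      push_cast at ih ⊢
      rw [abs_le] at *
      constructor <;> linarith [h1.1, h1.2, ih.1, ih.2]

theorem map_boundary_elem (b : BoundaryCurve G) : f b.elem = b.winding * f b.loop := by
  rw [BoundaryCurve.elem, hf.map_conj, hf.map_zpow]

/-- A homogeneous quasimorphism bounds the complexity of a connected surface. One boundary
component is moved to the other side of the surface relation, which saves one defect. -/
theorem abs_sum_boundary_le (S : MappedSurface G) :
    |(S.boundary.map fun b => (b.winding : ℝ) * f b.loop).sum| ≤ D * S.complexity := by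
  have hrel := S.relation
  have hc : S.complexity = 2 * S.handles.length + S.boundary.length - 2 := rfl
  rw [hc]
  simp only [← hf.map_boundary_elem]
  generalize S.handles = hs at *
  generalize S.boundary = bs at *
  rcases bs with _ | ⟨b, bs⟩
  · simpa using mul_nonneg hf.nonneg (Nat.cast_nonneg _)
  set A := hs.map fun h => h.1 * h.2 * h.1⁻¹ * h.2⁻¹ with hA
  have hAlen : A.length = hs.length := by simp [hA]
  have hAsum : |(A.map f).sum| ≤ D * hs.length := by
    clear hrel hc
    rw [hA]
    clear hAlen hA
    clear A
    induction hs with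
    | nil => simp
    | cons h hs ih =>
      have h1 := hf.abs_map_commutator_le h.1 h.2
      simp only [List.map_cons, List.sum_cons, List.length_cons]
      push_cast
      rw [abs_le] at *
      constructor <;> linarith [h1.1, h1.2, ih.1, ih.2]
  -- the inverse of `b` is the product of all the other factors, in a cyclic order
  have hinv : b.elem⁻¹ = (bs.map BoundaryCurve.elem ++ A).prod := by
    rw [List.map_cons, List.prod_cons] at hrel
    rw [List.prod_append, inv_eq_iff_mul_eq_one, ← mul_assoc]
    exact mul_eq_one_comm.1 (by rwa [← mul_assoc] at hrel ⊢)
  have h2 := hf.abs_map_list_prod_sub_sum_le (bs.map BoundaryCurve.elem ++ A)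
  rw [← hinv, hf.map_inv, List.map_append, List.sum_append, List.length_append, List.length_map,
    hAlen, List.map_map] at h2
  simp only [List.map_cons, List.sum_cons, List.length_cons]
  have h3 : (bs.map fun a => f a.elem) = bs.map (f ∘ BoundaryCurve.elem) := rfl
  rw [h3]
  by_cases h0 : bs.length + hs.length = 0
  · have hb : bs = [] := by
      apply List.eq_nil_of_length_eq_zero
      omega
    have hh : hs = [] := by
      apply List.eq_nil_of_length_eq_zero
      omega
    subst hb hh
    have : b.elem = 1 := by simpa [hA] using hinv
    simp [this, hf.map_one]
  · have e1 : ((bs.length + hs.length - 1 : ℕ) : ℝ) = bs.length + hs.length - 1 := by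
      rw [Nat.cast_sub (by omega)]
      push_cast
      ring
    have e2 : ((2 * hs.length + (bs.length + 1) - 2 : ℕ) : ℝ) =
        2 * hs.length + bs.length - 1 := by
      rw [Nat.cast_sub (by omega)]
      push_cast
      ring
    rw [e1] at h2
    rw [e2]
    rw [abs_le] at *
    constructor <;> linarith [h2.1, h2.2, hAsum.1, hAsum.2]

omit hf in
theorem map_boundaryChain (S : MappedSurface G) :
    Finsupp.linearCombination ℤ f S.boundaryChain =
      (S.boundary.map fun b => (b.winding : ℝ) * f b.loop).sum := by
  rw [MappedSurface.boundaryChain, map_list_sum, List.map_map]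
  congr 1
  refine List.map_congr_left fun b _ => ?_
  simp [Finsupp.linearCombination_single]

theorem abs_map_sum_boundaryChain_le (S : List (MappedSurface G)) :
    |Finsupp.linearCombination ℤ f (S.map MappedSurface.boundaryChain).sum| ≤
      D * (S.map MappedSurface.complexity).sum := by
  induction S with
  | nil => simp
  | cons T S ih =>
    have h1 := hf.abs_sum_boundary_le T
    rw [← map_boundaryChain] at h1
    rw [List.map_cons, List.sum_cons, map_add, List.map_cons, List.sum_cons, Nat.cast_add, mul_add]
    exact (abs_add_le _ _).trans (add_le_add h1 ih)

/-- The easy half of Bavard duality: a homogeneous quasimorphism bounds `scl` from below. -/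
theorem le_scl (hD : 0 < D) (c : IntegralChain G) {r : ℝ}
    (hr : 2 * D * r ≤ |Finsupp.linearCombination ℤ f c|) : ENNReal.ofReal r ≤ scl c := by
  refine le_iInf fun S => le_iInf fun n => le_iInf fun hS => ?_
  obtain ⟨hn, -, hsum⟩ := hS
  have h1 := hf.abs_map_sum_boundaryChain_le S
  rw [hsum, map_nsmul, nsmul_eq_mul, abs_mul, Nat.abs_cast] at h1
  have hn' : (0 : ℝ) < n := Nat.cast_pos.2 hn
  have h2 : r ≤ ((S.map MappedSurface.complexity).sum : ℕ) / (2 * (n : ℝ)) := by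
    rw [le_div_iff₀ (by positivity)]
    refine le_of_mul_le_mul_left ?_ hD
    calc D * (r * (2 * n)) = n * (2 * D * r) := by ring
      _ ≤ n * |Finsupp.linearCombination ℤ f c| := by gcongr
      _ ≤ _ := h1
  refine (ENNReal.ofReal_le_ofReal h2).trans (le_of_eq ?_)
  rw [ENNReal.ofReal_div_of_pos (by positivity), ENNReal.ofReal_natCast,
    ENNReal.ofReal_mul (by norm_num), ENNReal.ofReal_natCast, ENNReal.ofReal_ofNat]

end IsHomogeneousQuasimorphism

namespace IsAntisymmQuasimorphism

open Filter Topology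

variable {G : Type*} [Group G] {f : G → ℝ} {D : ℝ} (hf : IsAntisymmQuasimorphism f D)
include hf

theorem map_one : f 1 = 0 := by
  have := hf.map_inv 1
  rw [inv_one] at this
  linarith

theorem nonneg : 0 ≤ D := (abs_nonneg _).trans (hf.defect 1 1)

theorem abs_map_commutator_le (g h : G) : |f (g * h * g⁻¹ * h⁻¹)| ≤ 3 * D := by
  have h1 := hf.defect g h
  have h2 := hf.defect (g * h) g⁻¹
  have h3 := hf.defect (g * h * g⁻¹) h⁻¹
  rw [hf.map_inv] at h2 h3
  rw [abs_le] at *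
  constructor <;> linarith [h1.1, h1.2, h2.1, h2.2, h3.1, h3.2]

/-- `(a b)²ᵐ` is `a²ᵐ w b²ᵐ` for a product `w` of `m` commutators, and `f` is at most `4 D m`
on all conjugates of such a product. -/
theorem exists_mul_pow_eq (a b : G) (m : ℕ) :
    ∃ w, (a * b) ^ (2 * m) = a ^ (2 * m) * w * b ^ (2 * m) ∧
      ∀ c, |f (c * w * c⁻¹)| ≤ 4 * D * m := by
  induction m with
  | zero => exact ⟨1, by simp, by simp [hf.map_one]⟩
  | succ m ih =>
    obtain ⟨w, hw, hfw⟩ := ih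
    -- with `A = a²ᵐ`, the new factor `a⁻¹ A⁻¹ b a b A b⁻²` is the conjugate by `a` of
    -- `X b Z X⁻¹ b⁻¹ Z⁻¹ = [X b, Z X⁻¹]`, where `X = A⁻¹` and `Z = a b`
    set p : G := a⁻¹ * (a ^ (2 * m))⁻¹ * b * a with hp
    set q : G := b * a ^ (2 * m) * a with hq
    refine ⟨p * q * p⁻¹ * q⁻¹ * (b ^ 2 * w * (b ^ 2)⁻¹), ?_, fun c => ?_⟩
    · rw [mul_add, mul_one, add_comm, pow_add, pow_add a, pow_add b, hw, hp, hq]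
      have : a ^ 2 * a ^ (2 * m) = a ^ (2 * m) * a * a := by
        rw [mul_assoc, ← sq, (Commute.pow_pow_self a 2 (2 * m)).eq]
      rw [this]
      simp only [mul_inv_rev, inv_inv, pow_two]
      group
    · have h1 := hf.abs_map_commutator_le (c * p * c⁻¹) (c * q * c⁻¹)
      have h2 := hfw (c * b ^ 2)
      have h3 := hf.defect (c * p * c⁻¹ * (c * q * c⁻¹) * (c * p * c⁻¹)⁻¹ * (c * q * c⁻¹)⁻¹)
        (c * b ^ 2 * w * (c * b ^ 2)⁻¹)
      have e : c * p * c⁻¹ * (c * q * c⁻¹) * (c * p * c⁻¹)⁻¹ * (c * q * c⁻¹)⁻¹ *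
          (c * b ^ 2 * w * (c * b ^ 2)⁻¹) =
          c * (p * q * p⁻¹ * q⁻¹ * (b ^ 2 * w * (b ^ 2)⁻¹)) * c⁻¹ := by group
      rw [e] at h3
      push_cast
      rw [abs_le] at *
      constructor <;> linarith [h1.1, h1.2, h2.1, h2.2, h3.1, h3.2]

theorem exists_tendsto (g : G) : ∃ l, Tendsto (fun n : ℕ => f (g ^ n) / n) atTop (𝓝 l) := by
  have hsub : Subadditive fun n : ℕ => f (g ^ n) + D := fun m n => by
    have := (abs_le.1 (hf.defect (g ^ m) (g ^ n))).2
    rw [← pow_add] at this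
    linarith
  have hlow : ∀ n : ℕ, n * (f g - D) - D ≤ f (g ^ n) := fun n => by
    induction n with
    | zero => simpa [hf.map_one] using hf.nonneg
    | succ n ih =>
      have := (abs_le.1 (hf.defect (g ^ n) g)).1
      rw [← pow_succ] at this
      push_cast
      linarith
  have hbdd : BddBelow (Set.range fun n : ℕ => (f (g ^ n) + D) / n) := by
    refine ⟨min 0 (f g - D), ?_⟩
    rintro _ ⟨n, rfl⟩
    rcases n.eq_zero_or_pos with rfl | hn
    · simp
    · refine (min_le_right _ _).trans ?_
      simp only
      rw [le_div_iff₀ (Nat.cast_pos.2 hn)]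
      linarith [hlow n]
  have h1 := hsub.tendsto_lim hbdd
  have h2 : Tendsto (fun n : ℕ => D / (n : ℝ)) atTop (𝓝 0) :=
    tendsto_const_div_atTop_nhds_zero_nat D
  refine ⟨_, (h1.sub h2).congr fun n => ?_⟩
  rw [← sub_div, add_sub_cancel_right]

/-- The homogenization of an antisymmetric quasimorphism of defect `D` has defect at most
`2 D`. -/
theorem exists_homogenization : ∃ h : G → ℝ, IsHomogeneousQuasimorphism h (2 * D) ∧
    ∀ g, Tendsto (fun n : ℕ => f (g ^ n) / n) atTop (𝓝 (h g)) := by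
  choose h hh using hf.exists_tendsto
  have hpow : ∀ g (n : ℕ), h (g ^ n) = n * h g := fun g n => by
    rcases n.eq_zero_or_pos with rfl | hn
    · refine tendsto_nhds_unique (hh _) ?_
      simp [hf.map_one]
    · have h1 : Tendsto (fun m : ℕ => n * (f (g ^ (n * m)) / (n * m : ℕ))) atTop
          (𝓝 (n * h g)) :=
        ((hh g).comp (tendsto_id.const_mul_atTop' hn)).const_mul _
      refine tendsto_nhds_unique (hh _) (h1.congr fun m => ?_)
      rw [pow_mul]
      push_cast
      have : (n : ℝ) ≠ 0 := by positivity
      field_simp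
  have hinv : ∀ g, h g⁻¹ = -h g := fun g => by
    refine tendsto_nhds_unique (hh _) ((hh g).neg.congr fun n => ?_)
    rw [inv_pow, hf.map_inv, neg_div]
  refine ⟨h, ⟨fun g n => ?_, fun a b => ?_⟩, hh⟩
  · obtain ⟨n, rfl | rfl⟩ := n.eq_nat_or_neg
    · rw [zpow_natCast, hpow, Int.cast_natCast]
    · rw [zpow_neg, hinv, zpow_natCast, hpow]
      push_cast
      ring
  · have h2 : Tendsto (fun m : ℕ => 2 * m) atTop atTop := tendsto_id.const_mul_atTop' two_pos
    have hlim := ((((hh (a * b)).comp h2).sub ((hh a).comp h2)).sub ((hh b).comp h2)).abs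
    have hup : Tendsto (fun m : ℕ => 2 * D + 2 * D * ((m : ℝ)⁻¹)) atTop (𝓝 (2 * D)) := by
      simpa using (tendsto_inv_atTop_nhds_zero_nat (𝕜 := ℝ)).const_mul (2 * D) |>.const_add (2 * D)
    refine le_of_tendsto_of_tendsto hlim hup (eventually_atTop.2 ⟨1, fun m hm => ?_⟩)
    obtain ⟨w, hw, hfw⟩ := hf.exists_mul_pow_eq a b m
    have hm' : (0 : ℝ) < m := Nat.cast_pos.2 hm
    have h3 := hfw 1
    have h4 := hf.defect (a ^ (2 * m) * w) (b ^ (2 * m))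
    have h5 := hf.defect (a ^ (2 * m)) w
    rw [← hw] at h4
    rw [one_mul, inv_one, mul_one] at h3
    have h6 : |f ((a * b) ^ (2 * m)) - f (a ^ (2 * m)) - f (b ^ (2 * m))| ≤
        4 * D * m + 2 * D := by
      rw [abs_le] at *
      constructor <;> linarith [h3.1, h3.2, h4.1, h4.2, h5.1, h5.2]
    have h7 : (0 : ℝ) < 2 * m := by positivity
    simp only [Function.comp_apply]
    push_cast
    rw [← sub_div, ← sub_div, abs_div, abs_of_pos h7, div_le_iff₀ h7]
    refine h6.trans ?_
    have := hf.nonneg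
    field_simp
    linarith

end IsAntisymmQuasimorphism

/-! ### Chains up to equivalence -/

/-- The space of real chains up to equivalence. -/
abbrev ChainSpace (G : Type*) [Group G] := RealChain G ⧸ chainRelations G

/-- The class of the chain `g`. -/
noncomputable def chainClass {G : Type*} [Group G] (g : G) : ChainSpace G :=
  (chainRelations G).mkQ (Finsupp.single g 1)

section ChainClass

variable {G : Type*} [Group G]

theorem chainClass_zpow (g : G) (n : ℤ) : chainClass (g ^ n) = n • chainClass g := by
  rw [chainClass, chainClass, ← Int.cast_smul_eq_zsmul ℝ, ← map_smul]
  refine (Submodule.Quotient.eq _).2 (Submodule.subset_span (Or.inl (Or.inl ⟨g, n, rfl⟩)))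

theorem chainClass_conj (g h : G) : chainClass (h * g * h⁻¹) = chainClass g :=
  (Submodule.Quotient.eq _).2 (Submodule.subset_span (Or.inl (Or.inr ⟨g, h, rfl⟩)))

theorem chainClass_mul {g h : G} (hgh : Commute g h) :
    chainClass (g * h) = chainClass g + chainClass h := by
  rw [chainClass, chainClass, chainClass, ← map_add]
  refine (Submodule.Quotient.eq _).2 (Submodule.subset_span (Or.inr ⟨g, h, hgh, ?_⟩))
  rw [sub_sub]

theorem chainClass_inv (g : G) : chainClass g⁻¹ = -chainClass g := by
  simpa using chainClass_zpow g (-1)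

theorem mkQ_toReal (c : IntegralChain G) :
    (chainRelations G).mkQ c.toReal = c.sum fun g n => n • chainClass g := by
  induction c using Finsupp.induction_linear with
  | zero => simp [IntegralChain.toReal]
  | add a b ha hb =>
    rw [Finsupp.sum_add_index' (by simp) (by intros; exact add_smul _ _ _), ← ha, ← hb, ← map_add]
    congr 1
    exact Finsupp.mapRange_add (by simp) a b
  | single g n =>
    rw [Finsupp.sum_single_index (by simp), ← Int.cast_smul_eq_zsmul ℝ, chainClass, ← map_smul]
    simp [IntegralChain.toReal]

/-- The classes of integral chains with all terms in the set `s`. -/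
noncomputable def chainSpan (s : Set G) : AddSubgroup (ChainSpace G) := AddSubgroup.closure (chainClass '' s)

theorem chainClass_mem_chainSpan {s : Set G} {g : G} (hg : g ∈ s) : chainClass g ∈ chainSpan s :=
  AddSubgroup.subset_closure ⟨g, hg, rfl⟩

theorem exists_integralChain_of_mem_chainSpan {s : Set G} {q : ChainSpace G}
    (hq : q ∈ chainSpan s) :
    ∃ c : IntegralChain G, (chainRelations G).mkQ c.toReal = q ∧ ∀ g ∈ c.support, g ∈ s := by
  classical
  induction hq using AddSubgroup.closure_induction with
  | mem q hq =>
    obtain ⟨g, hg, rfl⟩ := hq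
    refine ⟨Finsupp.single g 1, ?_, fun h hh => ?_⟩
    · rw [mkQ_toReal, Finsupp.sum_single_index (by simp), one_smul]
    · rw [Finset.mem_singleton.1 (Finsupp.support_single_subset hh)]
      exact hg
  | zero => exact ⟨0, by rw [mkQ_toReal, Finsupp.sum_zero_index], by simp⟩
  | add a b _ _ ha hb =>
    obtain ⟨c, rfl, hc⟩ := ha
    obtain ⟨d, rfl, hd⟩ := hb
    refine ⟨c + d, ?_, fun g hg => ?_⟩
    · rw [mkQ_toReal, Finsupp.sum_add_index' (by simp) (by intros; exact add_smul _ _ _),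
        mkQ_toReal, mkQ_toReal]
    · exact (Finset.mem_union.1 (Finsupp.support_add hg)).elim (hc g) (hd g)
  | neg a _ ha =>
    obtain ⟨c, rfl, hc⟩ := ha
    refine ⟨-c, ?_, fun g hg => hc g (by simpa using hg)⟩
    rw [mkQ_toReal, Finsupp.sum_neg_index (by simp), mkQ_toReal, ← Finsupp.sum_neg]
    simp

theorem IsHomogeneousQuasimorphism.exists_linearMap {f : G → ℝ} {D : ℝ}
    (hf : IsHomogeneousQuasimorphism f D) :
    ∃ φ : ChainSpace G →ₗ[ℝ] ℝ, ∀ g, φ (chainClass g) = f g := by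
  have hle : chainRelations G ≤ LinearMap.ker (Finsupp.linearCombination ℝ f) := by
    refine Submodule.span_le.2 ?_
    rintro z ((⟨g, n, rfl⟩ | ⟨g, h, rfl⟩) | ⟨g, h, hgh, rfl⟩)
    · simp [hf.map_zpow]
    · simp [hf.map_conj]
    · simp [hf.map_mul_of_commute hgh]
  refine ⟨(chainRelations G).liftQ (Finsupp.linearCombination ℝ f) hle, fun g => ?_⟩
  exact (Submodule.liftQ_apply _ _ _).trans (by simp)

theorem map_mkQ_toReal {f : G → ℝ} (φ : ChainSpace G →ₗ[ℝ] ℝ) (hφ : ∀ g, φ (chainClass g) = f g)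
    (c : IntegralChain G) :
    φ ((chainRelations G).mkQ c.toReal) = Finsupp.linearCombination ℤ f c := by
  rw [mkQ_toReal, Finsupp.linearCombination_apply, Finsupp.sum, Finsupp.sum, map_sum]
  simp [map_zsmul, hφ]

end ChainClass

/-! ### CM-subgroup sequences along an element -/

section CMSequence

variable {G : Type*} [Group G]

/-- A CM-subgroup sequence `H` of length `m + 1` that starts with `⊤, C`, with CM-representatives
`t 0, …, t m` which define its centralizers, and an expression of `g` as `t 0 ⋯ t m * c`, where `c`
lies in the last but one group of the sequence. -/
structure IsCMFactorization (C : Subgroup G) (g : G) (m : ℕ) (H : ℕ → Subgroup G) (t : ℕ → G)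
    (c : G) : Prop where
  zero : H 0 = ⊤
  one : H 1 = C
  lt : ∀ i ≤ m, H (i + 1) < H i
  cm : ∀ i ≤ m, IsCMSubgroup (H (i + 1)) (H i)
  mem : ∀ i ≤ m, t i ∈ H i
  notMem : ∀ i ≤ m, t i ∉ H (i + 1)
  rep : ∀ i ≤ m, IsCMRep (H (i + 1)) (t i)
  centralizer : ∀ i ≤ m, H (i + 2) = H (i + 1) ⊓ Subgroup.centralizer {t i}
  last_mem : c ∈ H (m + 1)
  eq : g = ((List.range (m + 1)).map t).prod * c

namespace IsCMFactorization

variable {C : Subgroup G} {g : G} {m : ℕ} {H : ℕ → Subgroup G} {t : ℕ → G} {c : G}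
  (h : IsCMFactorization C g m H t c)
include h

theorem isCMSequence : IsCMSequence m H :=
  ⟨h.zero, fun i hi => ⟨h.lt i hi, h.cm i hi, t i, h.mem i hi, h.notMem i hi, h.rep i hi,
    h.centralizer i hi⟩⟩

theorem le_of_le {i j : ℕ} (hij : i ≤ j) (hj : j ≤ m + 2) : H j ≤ H i := by
  induction j, hij using Nat.le_induction with
  | base => exact le_rfl
  | succ j _ ih =>
    refine le_trans ?_ (ih (by omega))
    rcases Nat.lt_or_ge m j with hjm | hjm
    · obtain rfl : j = m + 1 := by omega
      rw [h.centralizer m le_rfl]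
      exact inf_le_left
    · exact (h.lt j hjm).le

theorem commute {i j : ℕ} (hij : i + 2 ≤ j) (hj : j ≤ m + 2) {k : G} (hk : k ∈ H j) :
    Commute k (t i) := by
  have h1 := h.le_of_le hij hj hk
  rw [h.centralizer i (by omega)] at h1
  exact Subgroup.mem_centralizer_singleton_iff.1 h1.2

theorem commute_prod {j : ℕ} (hj : j ≤ m + 1) {k : G} (hk : k ∈ H (j + 1)) :
    Commute k ((List.range j).map t).prod := by
  refine Commute.list_prod_right _ _ fun y hy => ?_
  obtain ⟨i, hi, rfl⟩ := List.mem_map.1 hy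
  exact h.commute (by have := List.mem_range.1 hi; omega) (by omega) hk

/-- If some `x` lies in the last but one group and not in the last one, then the sequence can be
extended. When `x = c`, the factorization of `g` extends along, up to a conjugation. -/
theorem exists_succ {D : ℕ} (hC : IsBCMS D C) {x : G} (hx : x ∈ H (m + 1)) (hx' : x ∉ H (m + 2)) :
    ∃ a ∈ H (m + 2), ∃ H' t' c',
      IsCMFactorization C (a * (((List.range (m + 1)).map t).prod * x) * a⁻¹) (m + 1) H' t' c' := by
  have h1 := (hC.2 m H h.isCMSequence h.one).1
  obtain ⟨hlt, hcm⟩ := h1.resolve_left fun e => hx' (e ▸ hx)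
  obtain ⟨a, ha, b, hb, hrep⟩ := hcm.2 x hx
  set r := a * x * b with hr
  have hmem : r ∈ H (m + 1) := mul_mem (mul_mem (hlt.le ha) hx) (hlt.le hb)
  have hnot : r ∉ H (m + 2) := fun hrm => hx' (by
    have : x = a⁻¹ * r * b⁻¹ := by rw [hr]; group
    rw [this]
    exact mul_mem (mul_mem (inv_mem ha) hrm) (inv_mem hb))
  have eH : ∀ i, i ≤ m + 2 → Function.update H (m + 3) (H (m + 2) ⊓ Subgroup.centralizer {r}) i =
      H i := fun i hi => Function.update_of_ne (by omega) _ _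
  have et : ∀ i, i ≤ m → Function.update t (m + 1) r i = t i :=
    fun i hi => Function.update_of_ne (by omega) _ _
  refine ⟨a, ha, Function.update H (m + 3) (H (m + 2) ⊓ Subgroup.centralizer {r}),
    Function.update t (m + 1) r, b⁻¹ * a⁻¹, ?_⟩
  have key : ∀ i ≤ m + 1, i ≤ m ∨ i = m + 1 := fun i hi => by omega
  constructor
  · rw [eH 0 (by omega), h.zero]
  · rw [eH 1 (by omega), h.one]
  · intro i hi
    rw [eH i (by omega), eH (i + 1) (by omega)]
    rcases key i hi with hi | rfl
    exacts [h.lt i hi, hlt]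
  · intro i hi
    rw [eH i (by omega), eH (i + 1) (by omega)]
    rcases key i hi with hi | rfl
    exacts [h.cm i hi, hcm]
  · intro i hi
    rw [eH i (by omega)]
    rcases key i hi with hi | rfl
    · rw [et i hi]
      exact h.mem i hi
    · rwa [Function.update_self]
  · intro i hi
    rw [eH (i + 1) (by omega)]
    rcases key i hi with hi | rfl
    · rw [et i hi]
      exact h.notMem i hi
    · rwa [Function.update_self]
  · intro i hi
    rw [eH (i + 1) (by omega)]
    rcases key i hi with hi | rfl
    · rw [et i hi]
      exact h.rep i hi
    · rwa [Function.update_self]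
  · intro i hi
    rw [eH (i + 1) (by omega)]
    rcases key i hi with hi | rfl
    · rw [et i hi, eH (i + 2) (by omega), h.centralizer i hi]
    · rw [Function.update_self, Function.update_self]
  · rw [eH (m + 2) le_rfl]
    exact mul_mem (inv_mem hb) (inv_mem ha)
  · have e : (List.range (m + 1)).map (Function.update t (m + 1) r) =
        (List.range (m + 1)).map t :=
      List.map_congr_left fun i hi => et i (by have := List.mem_range.1 hi; omega)
    rw [List.range_succ (n := m + 1), List.map_append, List.prod_append, e]
    have hcomm := h.commute_prod le_rfl ha
    simp only [List.map_cons, List.map_nil, List.prod_cons, List.prod_nil, mul_one,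
      Function.update_self, hr]
    rw [← mul_assoc, hcomm.eq]
    group

/-- If `k` and its conjugates by `g⁻¹, …, g⁻ʲ` lie in `C`, then `k` lies in the group number `j + 1`
of the sequence. -/
theorem mem_of_forall_conj_mem {j : ℕ} (hj : j ≤ m + 1) {k : G}
    (hk : ∀ i ≤ j, (g ^ i)⁻¹ * k * g ^ i ∈ C) : k ∈ H (j + 1) := by
  induction j generalizing k with
  | zero =>
    rw [h.one]
    simpa using hk 0 le_rfl
  | succ j ih =>
    have h1 : k ∈ H (j + 1) := ih (by omega) fun i hi => hk i (by omega)
    have h2 : g⁻¹ * k * g ∈ H (j + 1) := ih (by omega) fun i hi => by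
      have := hk (i + 1) (by omega)
      rw [pow_succ'] at this
      convert this using 1
      group
    -- write `g = p * t j * s` with `s ∈ H (j + 1)`, where `k` commutes with `p`
    obtain ⟨s, hs, hgs⟩ : ∃ s ∈ H (j + 1), g = ((List.range j).map t).prod * t j * s := by
      have hgen : ∀ n, j + 1 + n = m + 1 → ∃ s ∈ H (j + 1),
          ((List.range (m + 1)).map t).prod = ((List.range j).map t).prod * t j * s := by
        intro n hn
        refine ⟨((List.range n).map fun i => t (j + 1 + i)).prod, ?_, ?_⟩
        · refine list_prod_mem fun y hy => ?_
          obtain ⟨i, hi, rfl⟩ := List.mem_map.1 hy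
          have := List.mem_range.1 hi
          exact h.le_of_le (by omega) (by omega) (h.mem (j + 1 + i) (by omega))
        · rw [← hn, List.range_add, List.map_append, List.prod_append, List.range_succ,
            List.map_append, List.prod_append, List.map_map]
          simp [Function.comp_def]
      obtain ⟨s, hs, e⟩ := hgen (m - j) (by omega)
      refine ⟨s * c, mul_mem hs (h.le_of_le (by omega) (by omega) h.last_mem), ?_⟩
      rw [← mul_assoc, ← e]
      exact h.eq
    have hcomm := h.commute_prod (by omega) h1
    have h3 : (t j)⁻¹ * k * t j ∈ H (j + 1) := by
      have : (t j)⁻¹ * k * t j = s * (g⁻¹ * k * g) * s⁻¹ := by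
        rw [hgs]
        have hc : k = ((List.range j).map t).prod⁻¹ * k * ((List.range j).map t).prod := by
          rw [mul_assoc, hcomm.eq]
          group
        nth_rw 1 [hc]
        group
      rw [this]
      exact mul_mem (mul_mem hs h2) (inv_mem hs)
    have h4 : t j * ((t j)⁻¹ * k * t j) * (t j)⁻¹ = k := by group
    have h5 := (h.rep j (by omega) _ h3).resolve_right (by rw [h4]; exact not_not.2 h1)
    rw [h4] at h5
    rw [h.centralizer j (by omega)]
    refine ⟨h1, Subgroup.mem_centralizer_singleton_iff.2 ?_⟩
    conv_rhs => rw [h5]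
    group

/-- Extending the factorization as long as possible, one arrives at a factor `c` in the last group
of the sequence, which then commutes with all the other factors. -/
theorem exists_maximal {D : ℕ} (hC : IsBCMS D C) :
    ∃ a ∈ C, ∃ m' H' t' c', IsCMFactorization C (a * g * a⁻¹) m' H' t' c' ∧ c' ∈ H' (m' + 2) := by
  obtain ⟨n, hn⟩ : ∃ n, n = D - m := ⟨_, rfl⟩
  induction n using Nat.strong_induction_on generalizing g m H t c with
  | _ n ih =>
    by_cases hc : c ∈ H (m + 2)
    · exact ⟨1, one_mem _, m, H, t, c, by simpa using h, hc⟩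
    · obtain ⟨a, ha, H', t', c', h'⟩ := h.exists_succ hC h.last_mem hc
      have hD := (hC.2 _ _ h'.isCMSequence h'.one).2
      obtain ⟨b, hb, m', H'', t'', c'', h'', hc''⟩ := ih (D - (m + 1)) (by omega) h' rfl
      refine ⟨b * a, mul_mem hb ?_, m', H'', t'', c'', ?_, hc''⟩
      · rw [← h.one]
        exact h.le_of_le (by omega) le_rfl ha
      · rw [← h.eq] at h''
        convert h'' using 1
        group

end IsCMFactorization

/-- Let `C` be BCMS-`D` and `g ∉ C`. Then `g = t * c` for commuting `t` and `c` such that `c ∈ C` and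
`t` centralizes the intersection of the conjugates `gʲ C g⁻ʲ`, `0 ≤ j ≤ D`. -/
theorem IsBCMS.exists_eq_mul {D : ℕ} {C : Subgroup G} (hC : IsBCMS D C) {g : G} (hg : g ∉ C) :
    ∃ t c, g = t * c ∧ Commute t c ∧ c ∈ C ∧
      ∀ k, (∀ j ≤ D, (g ^ j)⁻¹ * k * g ^ j ∈ C) → Commute k t := by
  obtain ⟨a, ha, b, hb, hrep⟩ := hC.1.2 g (Subgroup.mem_top g)
  have hnot : a * g * b ∉ C := fun hr => hg (by
    have : g = a⁻¹ * (a * g * b) * b⁻¹ := by group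
    rw [this]
    exact mul_mem (mul_mem (inv_mem ha) hr) (inv_mem hb))
  set r := a * g * b with hr
  -- the factorization of length one, of a conjugate of `g`
  have h0 : IsCMFactorization C (a * g * a⁻¹) 0
      (fun i => if i = 0 then ⊤ else if i = 1 then C else C ⊓ Subgroup.centralizer {r})
      (fun _ => r) (b⁻¹ * a⁻¹) := by
    have h1 : ∀ i : ℕ, i ≤ 0 → i = 0 := fun i hi => by omega
    constructor
    · simp
    · simp
    · intro i hi
      obtain rfl := h1 i hi
      have : C ≠ ⊤ := fun e => hnot (by rw [e]; exact Subgroup.mem_top r)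
      simpa [lt_top_iff_ne_top] using this
    · intro i hi
      obtain rfl := h1 i hi
      simpa using hC.1
    · intro i hi
      obtain rfl := h1 i hi
      simp
    · intro i hi
      obtain rfl := h1 i hi
      simpa using hnot
    · intro i hi
      obtain rfl := h1 i hi
      simpa using hrep
    · intro i hi
      obtain rfl := h1 i hi
      simp
    · simpa using mul_mem (inv_mem hb) (inv_mem ha)
    · simp only [zero_add, List.range_one, List.map_cons, List.map_nil, List.prod_cons,
        List.prod_nil, mul_one, hr]
      group
  obtain ⟨a', ha', m, H, t, c, h, hc⟩ := h0.exists_maximal hC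
  have hD := (hC.2 _ _ h.isCMSequence h.one).2
  set p := ((List.range (m + 1)).map t).prod with hp
  set d := a' * a with hd
  have hdC : d ∈ C := mul_mem ha' ha
  have heq : d * g * d⁻¹ = p * c := by
    rw [← h.eq, hd]
    group
  have hpc : Commute p c := (h.commute_prod le_rfl hc).symm
  have hcC : c ∈ C := by
    rw [← h.one]
    exact h.le_of_le (by omega) le_rfl hc
  refine ⟨d⁻¹ * p * d, d⁻¹ * c * d, ?_, ?_, mul_mem (mul_mem (inv_mem hdC) hcC) hdC,
    fun k hk => ?_⟩
  · have : g = d⁻¹ * (d * g * d⁻¹) * d := by group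
    rw [this, heq]
    group
  · have := hpc.eq
    calc d⁻¹ * p * d * (d⁻¹ * c * d) = d⁻¹ * (p * c) * d := by group
      _ = d⁻¹ * (c * p) * d := by rw [this]
      _ = d⁻¹ * c * d * (d⁻¹ * p * d) := by group
  · have hk' : ∀ j ≤ D, ((a' * (a * g * a⁻¹) * a'⁻¹) ^ j)⁻¹ * (d * k * d⁻¹) *
        (a' * (a * g * a⁻¹) * a'⁻¹) ^ j ∈ C := fun j hj => by
      have e : a' * (a * g * a⁻¹) * a'⁻¹ = d * g * d⁻¹ := by rw [hd]; group
      rw [e, conj_pow]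
      have := mul_mem (mul_mem hdC (hk j hj)) (inv_mem hdC)
      convert this using 1
      group
    have hmem : d * k * d⁻¹ ∈ H (m + 2) := by
      rcases Nat.lt_or_ge m D with hmD | hmD
      · exact h.mem_of_forall_conj_mem le_rfl fun i hi => hk' i (by omega)
      · -- a sequence of maximal length is stationary at its end
        obtain rfl : m = D := le_antisymm hD hmD
        by_contra hx
        have hx1 := h.mem_of_forall_conj_mem (j := m) (by omega) hk'
        obtain ⟨_, _, _, _, _, h'⟩ := h.exists_succ hC hx1 hx
        have := (hC.2 _ _ h'.isCMSequence h'.one).2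
        omega
    have h1 := (h.commute_prod le_rfl hmem).eq
    change k * (d⁻¹ * p * d) = d⁻¹ * p * d * k
    calc k * (d⁻¹ * p * d) = d⁻¹ * (d * k * d⁻¹ * p) * d := by group
      _ = d⁻¹ * (p * (d * k * d⁻¹)) * d := by rw [h1]
      _ = d⁻¹ * p * d * k := by group

end CMSequence

/-! ### Geodesics and lines in a tree -/

section Tree

variable {X : Type*} {Γ : SimpleGraph X}

/-- The geodesic from `x` to `y` in a tree, as a list of oriented edges. -/
noncomputable def SimpleGraph.IsTree.seg (hΓ : Γ.IsTree) (x y : X) : List (X × X) :=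
  (hΓ.existsUnique_path x y).choose.darts.map (·.toProd)

theorem SimpleGraph.IsTree.seg_eq (hΓ : Γ.IsTree) {x y : X} {p : Γ.Walk x y} (hp : p.IsPath) :
    hΓ.seg x y = p.darts.map (·.toProd) := by
  rw [SimpleGraph.IsTree.seg,
    (hΓ.existsUnique_path x y).unique (hΓ.existsUnique_path x y).choose_spec.1 hp]

theorem SimpleGraph.IsTree.length_eq_dist (hΓ : Γ.IsTree) {x y : X} {p : Γ.Walk x y}
    (hp : p.IsPath) : p.length = Γ.dist x y := by
  obtain ⟨q, hq, hl⟩ := hΓ.connected.exists_path_of_dist x y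
  rw [(hΓ.existsUnique_path x y).unique hp hq, hl]

/-- Either the geodesic from `x` to `y` passes through `o`, or the geodesics from `o` to `x` and to
`y` share their first edge. -/
theorem SimpleGraph.IsTree.seg_append_or (hΓ : Γ.IsTree) (x o y : X) :
    hΓ.seg x y = hΓ.seg x o ++ hΓ.seg o y ∨
      ∃ u, Γ.Adj u o ∧ Γ.dist x u < Γ.dist x o ∧ Γ.dist y u < Γ.dist y o := by
  obtain ⟨p, hp, -⟩ := hΓ.existsUnique_path o x
  obtain ⟨q, hq, -⟩ := hΓ.existsUnique_path o y
  by_cases hpq : (p.reverse.append q).IsPath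
  · left
    rw [hΓ.seg_eq hpq, hΓ.seg_eq hp.reverse, hΓ.seg_eq hq, SimpleGraph.Walk.darts_append,
      List.map_append]
  · right
    have hpl := hΓ.length_eq_dist hp
    have hql := hΓ.length_eq_dist hq
    rcases p with _ | ⟨hop, p⟩
    · exact absurd hq (by simpa using hpq)
    rename_i u
    rcases q with _ | ⟨hoq, q⟩
    · exact absurd hp.reverse (by simpa using hpq)
    rename_i u'
    have huu : u = u' := by
      by_contra hne
      apply hpq
      rw [hΓ.isAcyclic.isPath_iff_isChain] at hp hq ⊢
      rw [SimpleGraph.Walk.edges_append, List.isChain_append]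
      refine ⟨?_, hq, ?_⟩
      · rw [SimpleGraph.Walk.edges_reverse, List.isChain_reverse]
        exact hp.imp fun _ _ h => h.symm
      · simp [SimpleGraph.Walk.edges_reverse, hne, hop.ne']
    subst huu
    refine ⟨u, hop.symm, ?_, ?_⟩
    · rw [Γ.dist_comm, Γ.dist_comm (u := x), ← hpl, SimpleGraph.Walk.length_cons]
      exact Nat.lt_succ_of_le (SimpleGraph.dist_le p)
    · rw [Γ.dist_comm, Γ.dist_comm (u := y), ← hql, SimpleGraph.Walk.length_cons]
      exact Nat.lt_succ_of_le (SimpleGraph.dist_le q)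

/-- Geodesic triangles in a tree are tripods: the centre minimizes the sum of the distances to
the three points. -/
theorem SimpleGraph.IsTree.exists_center (hΓ : Γ.IsTree) (x y z : X) :
    ∃ o, ∀ a ∈ ({x, y, z} : Set X), ∀ b ∈ ({x, y, z} : Set X), a ≠ b →
      hΓ.seg a b = hΓ.seg a o ++ hΓ.seg o b := by
  have : Nonempty X := ⟨x⟩
  let F : X → ℕ := fun o => Γ.dist x o + Γ.dist y o + Γ.dist z o
  obtain ⟨o, ho⟩ : ∃ o, ∀ u, F o ≤ F u := ⟨_, fun u => Function.argmin_le F u⟩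
  refine ⟨o, fun a ha b hb hab => ?_⟩
  refine (hΓ.seg_append_or a o b).resolve_right ?_
  rintro ⟨u, huo, hau, hbu⟩
  have hmin := ho u
  have hstep : ∀ c, Γ.dist c u ≤ Γ.dist c o + 1 := fun c =>
    (hΓ.connected.dist_triangle (v := o)).trans
      (by rw [SimpleGraph.dist_eq_one_iff_adj.2 huo.symm])
  have hx := hstep x
  have hy := hstep y
  have hz := hstep z
  simp only [F] at hmin
  clear ho F
  rcases ha with rfl | rfl | rfl <;> rcases hb with rfl | rfl | rfl <;>
    first | exact absurd rfl hab | omega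

/-- `ℓ` is a bi-infinite edge path without backtracking. -/
structure IsLine (Γ : SimpleGraph X) (ℓ : ℤ → X) : Prop where
  adj : ∀ i, Γ.Adj (ℓ i) (ℓ (i + 1))
  ne : ∀ i, ℓ i ≠ ℓ (i + 2)

namespace IsLine

variable {ℓ : ℤ → X}

theorem shift (h : IsLine Γ ℓ) (s : ℤ) : IsLine Γ fun k => ℓ (s + k) :=
  ⟨fun i => by simpa [add_assoc] using h.adj (s + i),
    fun i => by simpa [add_assoc] using h.ne (s + i)⟩

theorem reflect (h : IsLine Γ ℓ) (s : ℤ) : IsLine Γ fun k => ℓ (s - k) := by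
  refine ⟨fun i => ?_, fun i => ?_⟩
  · have := (h.adj (s - (i + 1))).symm
    rwa [show s - (i + 1) + 1 = s - i by ring] at this
  · have := (h.ne (s - (i + 2))).symm
    rwa [show s - (i + 2) + 2 = s - i by ring] at this

theorem seg_eq (hΓ : Γ.IsTree) (h : IsLine Γ ℓ) (i : ℤ) (n : ℕ) :
    hΓ.seg (ℓ i) (ℓ (i + n)) = (List.range n).map fun k : ℕ => (ℓ (i + k), ℓ (i + k + 1)) := by
  have key : ∀ n : ℕ, ∀ j, j = i + n → ∃ p : Γ.Walk (ℓ i) (ℓ j),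
      p.darts.map (·.toProd) = (List.range n).map fun k : ℕ => (ℓ (i + k), ℓ (i + k + 1)) := by
    intro n
    induction n with
    | zero =>
      rintro j rfl
      exact ⟨SimpleGraph.Walk.nil.copy rfl (by simp), by simp⟩
    | succ n ih =>
      rintro j rfl
      obtain ⟨p, hp⟩ := ih _ rfl
      refine ⟨(p.concat (h.adj _)).copy rfl (by push_cast; rw [add_assoc]), ?_⟩
      rw [SimpleGraph.Walk.darts_copy, SimpleGraph.Walk.darts_concat, List.concat_eq_append,
        List.map_append, hp, List.range_succ, List.map_append]
      simp
  obtain ⟨p, hp⟩ := key n _ rfl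
  rw [← hp]
  refine hΓ.seg_eq ?_
  rw [hΓ.isAcyclic.isPath_iff_isChain]
  have he : p.edges = (p.darts.map (·.toProd)).map fun q => s(q.1, q.2) := by
    rw [List.map_map]
    rfl
  rw [he, hp, List.map_map, List.isChain_map, List.isChain_range]
  intro m _ heq
  have h1 := h.ne (i + m)
  simp only [Function.comp_apply, Sym2.eq_iff] at heq
  push_cast at heq
  rcases heq with ⟨h2, -⟩ | ⟨h2, -⟩
  · rw [← add_assoc] at h2
    exact (h.adj (i + m)).ne h2
  · rw [show i + ((m : ℤ) + 1) + 1 = i + m + 2 by ring] at h2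
    exact h1 h2

end IsLine

/-- An action of a group on a tree, without inversions of edges. -/
structure IsTreeAction (G : Type*) [Group G] [MulAction G X] (Γ : SimpleGraph X) : Prop where
  isTree : Γ.IsTree
  adj_smul : ∀ (g : G) {x y : X}, Γ.Adj x y → Γ.Adj (g • x) (g • y)
  no_inversion : ∀ (g : G) {x y : X}, Γ.Adj x y → g • x = y → g • y ≠ x

namespace IsTreeAction

variable {G : Type*} [Group G] [MulAction G X] (hT : IsTreeAction G Γ)
include hT

theorem seg_smul (g : G) (x y : X) :
    hT.isTree.seg (g • x) (g • y) = (hT.isTree.seg x y).map (g • ·) := by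
  obtain ⟨p, hp, -⟩ := hT.isTree.existsUnique_path x y
  let f : Γ →g Γ := ⟨(g • ·), hT.adj_smul g⟩
  have hfp : (p.map f).IsPath :=
    hp.map (MulAction.injective g)
  rw [hT.isTree.seg_eq hp]
  refine (hT.isTree.seg_eq hfp).trans ?_
  rw [SimpleGraph.Walk.darts_map, List.map_map, List.map_map]
  rfl

theorem isLine_smul {ℓ : ℤ → X} (h : IsLine Γ ℓ) (g : G) : IsLine Γ fun k => g • ℓ k :=
  ⟨fun i => hT.adj_smul g (h.adj i), fun i e => h.ne i (MulAction.injective g e)⟩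

theorem smul_eq_of_between {ℓ : ℤ → X} (h : IsLine Γ ℓ) {g : G} {i j m : ℤ} (him : i ≤ m)
    (hmj : m ≤ j) (hi : g • ℓ i = ℓ i) (hj : g • ℓ j = ℓ j) : g • ℓ m = ℓ m := by
  obtain ⟨n, rfl⟩ := Int.le.dest (him.trans hmj)
  obtain ⟨k, rfl⟩ := Int.le.dest him
  have h1 := hT.seg_smul g (ℓ i) (ℓ (i + n))
  rw [hi, hj, h.seg_eq, List.map_map, List.map_inj_left] at h1
  rcases Nat.lt_or_ge k n with hk | hk
  · exact ((Prod.ext_iff.1 (h1 k (List.mem_range.2 hk))).1).symm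
  · have : k = n := by omega
    rwa [this]

/-- An element without fixed points translates a line. -/
theorem exists_axis {g : G} (hg : ∀ x : X, g • x ≠ x) :
    ∃ (τ : ℕ) (ℓ : ℤ → X), 0 < τ ∧ IsLine Γ ℓ ∧ ∀ i, g • ℓ i = ℓ (i + τ) := by
  have := hT.isTree.connected.nonempty
  set v : X := Function.argmin (fun x : X => Γ.dist x (g • x)) with hv
  set τ := Γ.dist v (g • v) with hτ
  have hmin : ∀ x, τ ≤ Γ.dist x (g • x) := fun x =>
    Function.argmin_le (fun x : X => Γ.dist x (g • x)) x
  have hτ0 : 0 < τ := (hT.isTree.connected.pos_dist_of_ne (hg v).symm)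
  obtain ⟨p, hp, -⟩ := hT.isTree.existsUnique_path v (g • v)
  have hlen : p.length = τ := hT.isTree.length_eq_dist hp
  have hend : p.getVert τ = g • p.getVert 0 := by
    rw [← hlen, p.getVert_length, p.getVert_zero]
  have hτZ : (0 : ℤ) < τ := by exact_mod_cast hτ0
  let ℓ : ℤ → X := fun i => g ^ (i / (τ : ℤ)) • p.getVert (i % (τ : ℤ)).toNat
  have hℓτ : ∀ i, g • ℓ i = ℓ (i + τ) := fun i => by
    simp only [ℓ]
    rw [show i + (τ : ℤ) = i + 1 * τ by ring, Int.add_mul_emod_self_right,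
      Int.add_mul_ediv_right _ _ hτZ.ne', smul_smul, ← zpow_one_add, add_comm]
  have hℓ : ∀ (q : ℤ) (r : ℕ), r ≤ τ → ℓ (q * τ + r) = g ^ q • p.getVert r := fun q r hr => by
    have hlt : ∀ (q : ℤ) (r : ℕ), r < τ → ℓ (q * τ + r) = g ^ q • p.getVert r := fun q r hr => by
      have h1 : (r : ℤ) < τ := by exact_mod_cast hr
      simp only [ℓ]
      rw [add_comm, Int.add_mul_ediv_right _ _ hτZ.ne', Int.add_mul_emod_self_right,
        Int.ediv_eq_zero_of_lt (by omega) h1, Int.emod_eq_of_lt (by omega) h1, zero_add,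
        Int.toNat_natCast]
    rcases hr.lt_or_eq with hr | rfl
    · exact hlt q r hr
    · have := hlt (q + 1) 0 hτ0
      rw [show q * (τ : ℤ) + τ = (q + 1) * τ + (0 : ℕ) by push_cast; ring, this, zpow_add_one,
        mul_smul, ← hend]
  have hdecomp : ∀ i : ℤ, ∃ (q : ℤ) (r : ℕ), r < τ ∧ i = q * τ + r := fun i => by
    refine ⟨i / τ, (i % τ).toNat, ?_, ?_⟩
    · have := Int.emod_lt_of_pos i hτZ
      have := Int.emod_nonneg i hτZ.ne'
      omega
    · rw [Int.toNat_of_nonneg (Int.emod_nonneg i hτZ.ne'), mul_comm, Int.mul_ediv_add_emod]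
  refine ⟨τ, ℓ, hτ0, ⟨fun i => ?_, fun i => ?_⟩, hℓτ⟩
  · obtain ⟨q, r, hr, rfl⟩ := hdecomp i
    have h2 := hℓ q (r + 1) hr
    push_cast at h2
    rw [hℓ q r hr.le, add_assoc, h2]
    exact hT.adj_smul _ (p.adj_getVert_succ (by omega))
  · obtain ⟨q, r, hr, rfl⟩ := hdecomp i
    intro heq
    rw [hℓ q r hr.le] at heq
    rcases Nat.lt_or_ge (r + 1) τ with hr2 | hr2
    · have h2 := hℓ q (r + 2) hr2
      push_cast at h2
      rw [add_assoc, h2] at heq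
      have := hp.getVert_injOn (by simp; omega) (by simp; omega) (MulAction.injective _ heq)
      omega
    · have hrτ : r + 1 = τ := by omega
      -- otherwise the geodesic from `v` to `g • v` could be shortened by moving `v` along it
      have h2 := hℓ (q + 1) 1 hτ0
      rw [show (q + 1) * (τ : ℤ) + (1 : ℕ) = q * τ + r + 2 by
        rw [← hrτ]; push_cast; ring, zpow_add_one, mul_smul] at h2
      rw [h2] at heq
      have heq' := MulAction.injective _ heq
      rcases Nat.lt_or_ge 1 τ with h1τ | h1τ
      · have hdist : ∀ n, n + 1 ≤ τ → Γ.dist (p.getVert 1) (p.getVert (1 + n)) ≤ n := by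
          intro n
          induction n with
          | zero => simp
          | succ n ih =>
            intro hn
            refine (hT.isTree.connected.dist_triangle (v := p.getVert (1 + n))).trans ?_
            have := p.adj_getVert_succ (i := 1 + n) (by omega)
            rw [← add_assoc, SimpleGraph.dist_eq_one_iff_adj.2 this]
            have := ih (by omega)
            omega
        have h3 := hdist (τ - 2) (by omega)
        rw [show 1 + (τ - 2) = r by omega, heq'] at h3
        have := hmin (p.getVert 1)
        omega
      · obtain rfl : r = 0 := by omega
        have hτ1 : τ = 1 := by omega
        have hadj : Γ.Adj v (g • v) := SimpleGraph.dist_eq_one_iff_adj.1 hτ1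
        rw [hτ1] at hend
        rw [hend, p.getVert_zero] at heq'
        exact hT.no_inversion g hadj rfl heq'.symm

end IsTreeAction

end Tree

/-! ### Counting quasimorphisms -/

section Count

variable {α : Type*} {P : List α → Prop}

/-- `Packs P k l`: the list `l` contains `k` pairwise disjoint sublists of consecutive entries that
satisfy `P`. -/
inductive Packs (P : List α → Prop) : ℕ → List α → Prop
  | zero (l : List α) : Packs P 0 l
  | succ {k : ℕ} (s : List α) {p l : List α} : P p → Packs P k l → Packs P (k + 1) (s ++ (p ++ l))

theorem Packs.append_left {k : ℕ} {l : List α} (h : Packs P k l) (s : List α) :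
    Packs P k (s ++ l) := by
  cases h with
  | zero => exact .zero _
  | succ s' hp h =>
    rw [← List.append_assoc]
    exact .succ _ hp h

theorem Packs.append {i j : ℕ} {a b : List α} (ha : Packs P i a) (hb : Packs P j b) :
    Packs P (i + j) (a ++ b) := by
  induction ha with
  | zero l =>
    rw [zero_add]
    exact hb.append_left l
  | succ s hp _ ih =>
    rw [List.append_assoc, List.append_assoc, add_right_comm]
    exact .succ s hp ih

/-- Cutting a list destroys at most one of the disjoint sublists. -/
theorem Packs.split {k : ℕ} {a b : List α} (h : Packs P k (a ++ b)) :
    ∃ i j, Packs P i a ∧ Packs P j b ∧ k ≤ i + j + 1 := by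
  generalize hl : a ++ b = l at h
  induction h generalizing a with
  | zero l => exact ⟨0, 0, .zero _, .zero _, by omega⟩
  | @succ k s p l hp h ih =>
    rw [← List.append_assoc, List.append_eq_append_iff] at hl
    rcases hl with ⟨c, hc, rfl⟩ | ⟨c, rfl, rfl⟩
    · exact ⟨0, k, .zero _, h.append_left _, by omega⟩
    · obtain ⟨i, j, hi, hj, hij⟩ := ih rfl
      refine ⟨i + 1, j, ?_, hj, by omega⟩
      rw [List.append_assoc]
      exact .succ s hp hi

theorem Packs.le_length (hP : ∀ p, P p → p ≠ []) {k : ℕ} {l : List α} (h : Packs P k l) :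
    k ≤ l.length := by
  induction h with
  | zero l => simp
  | succ s hp _ ih =>
    have := List.length_pos_iff.2 (hP _ hp)
    simp only [List.length_append]
    omega

theorem Packs.map {f : α → α} (hf : ∀ p, P p → P (p.map f)) {k : ℕ} {l : List α}
    (h : Packs P k l) : Packs P k (l.map f) := by
  induction h with
  | zero l => exact .zero _
  | succ s hp _ ih =>
    rw [List.map_append, List.map_append]
    exact .succ _ (hf _ hp) ih

/-- The maximal number of disjoint sublists of consecutive entries that satisfy `P`. -/
noncomputable def packCount (P : List α → Prop) (l : List α) : ℕ := sSup {k | Packs P k l}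

theorem bddAbove_packs (hP : ∀ p, P p → p ≠ []) (l : List α) : BddAbove {k | Packs P k l} :=
  ⟨l.length, fun _ h => h.le_length hP⟩

theorem Packs.le_packCount (hP : ∀ p, P p → p ≠ []) {k : ℕ} {l : List α} (h : Packs P k l) :
    k ≤ packCount P l := le_csSup (bddAbove_packs hP l) h

theorem packs_packCount (hP : ∀ p, P p → p ≠ []) (l : List α) : Packs P (packCount P l) l :=
  Nat.sSup_mem ⟨0, .zero l⟩ (bddAbove_packs hP l)

theorem packCount_append_ge (hP : ∀ p, P p → p ≠ []) (a b : List α) :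
    packCount P a + packCount P b ≤ packCount P (a ++ b) :=
  ((packs_packCount hP a).append (packs_packCount hP b)).le_packCount hP

theorem packCount_append_le (hP : ∀ p, P p → p ≠ []) (a b : List α) :
    packCount P (a ++ b) ≤ packCount P a + packCount P b + 1 := by
  obtain ⟨i, j, hi, hj, hij⟩ := (packs_packCount hP (a ++ b)).split
  have := hi.le_packCount hP
  have := hj.le_packCount hP
  omega

theorem packCount_map_le (hP : ∀ p, P p → p ≠ []) {f : α → α} (hf : ∀ p, P p → P (p.map f))
    (l : List α) : packCount P l ≤ packCount P (l.map f) :=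
  ((packs_packCount hP l).map hf).le_packCount hP

theorem packCount_eq_zero (hP : ∀ p, P p → p ≠ []) {l : List α} (h : ∀ p, P p → ¬p <:+: l) :
    packCount P l = 0 := by
  have h1 := packs_packCount hP l
  generalize packCount P l = k at h1 ⊢
  cases h1 with
  | zero => rfl
  | succ s hp _ =>
    rename_i p l _
    exact absurd ⟨s, l, by simp⟩ (h p hp)

end Count

namespace IsTreeAction

open Filter Topology

variable {X : Type*} {Γ : SimpleGraph X} {G : Type*} [Group G] [MulAction G X]
  (hT : IsTreeAction G Γ) {P : List (X × X) → Prop}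

/-- The number of disjoint segments satisfying `P` on the geodesic from `x` to `y`, minus the
number of those on the geodesic from `y` to `x`. -/
noncomputable def countDiff (P : List (X × X) → Prop) (x y : X) : ℝ :=
  packCount P (hT.isTree.seg x y) - packCount P (hT.isTree.seg y x)

theorem countDiff_symm (x y : X) : hT.countDiff P y x = -hT.countDiff P x y := by
  simp [countDiff]

theorem countDiff_smul (hP : ∀ p, P p → p ≠ []) (hPG : ∀ (g : G) p, P p → P (p.map (g • ·)))
    (g : G) (x y : X) : hT.countDiff P (g • x) (g • y) = hT.countDiff P x y := by
  have key : ∀ x y, packCount P (hT.isTree.seg (g • x) (g • y)) =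
      packCount P (hT.isTree.seg x y) := fun x y => by
    rw [hT.seg_smul]
    refine le_antisymm ?_ (packCount_map_le hP (hPG g) _)
    refine (packCount_map_le hP (hPG g⁻¹) _).trans (le_of_eq ?_)
    rw [List.map_map]
    congr 1
    convert List.map_id _
    ext q <;> simp
  rw [countDiff, countDiff, key, key]

/-- Each side of a tripod has at most one segment across the centre. -/
theorem abs_countDiff_triangle_le (hP : ∀ p, P p → p ≠ []) (x y z : X) :
    |hT.countDiff P x y + hT.countDiff P y z + hT.countDiff P z x| ≤ 3 := by
  have hself : ∀ x, hT.countDiff P x x = 0 := fun x => by simp [countDiff]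
  by_cases hxy : x = y
  · subst hxy
    rw [hself, hT.countDiff_symm x z]
    simp
  by_cases hyz : y = z
  · subst hyz
    rw [hself, hT.countDiff_symm x y]
    simp
  by_cases hzx : z = x
  · subst hzx
    rw [hself, hT.countDiff_symm z y]
    simp
  obtain ⟨o, ho⟩ := hT.isTree.exists_center x y z
  have hside : ∀ a ∈ ({x, y, z} : Set X), ∀ b ∈ ({x, y, z} : Set X), a ≠ b →
      |hT.countDiff P a b - hT.countDiff P a o + hT.countDiff P b o| ≤ 1 := fun a ha b hb hab => by
    simp only [countDiff]
    rw [ho a ha b hb hab, ho b hb a ha hab.symm]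
    have h1 : ((packCount P (hT.isTree.seg a o) + packCount P (hT.isTree.seg o b) : ℕ) : ℝ) ≤ _ :=
      Nat.cast_le.2 (packCount_append_ge hP (hT.isTree.seg a o) (hT.isTree.seg o b))
    have h2 : (_ : ℝ) ≤ ((packCount P (hT.isTree.seg a o) +
        packCount P (hT.isTree.seg o b) + 1 : ℕ) : ℝ) :=
      Nat.cast_le.2 (packCount_append_le hP (hT.isTree.seg a o) (hT.isTree.seg o b))
    have h3 : ((packCount P (hT.isTree.seg b o) + packCount P (hT.isTree.seg o a) : ℕ) : ℝ) ≤ _ :=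
      Nat.cast_le.2 (packCount_append_ge hP (hT.isTree.seg b o) (hT.isTree.seg o a))
    have h4 : (_ : ℝ) ≤ ((packCount P (hT.isTree.seg b o) +
        packCount P (hT.isTree.seg o a) + 1 : ℕ) : ℝ) :=
      Nat.cast_le.2 (packCount_append_le hP (hT.isTree.seg b o) (hT.isTree.seg o a))
    push_cast at h1 h2 h3 h4
    rw [abs_le]
    constructor <;> linarith
  have h1 := hside x (by simp) y (by simp) hxy
  have h2 := hside y (by simp) z (by simp) hyz
  have h3 := hside z (by simp) x (by simp) hzx
  rw [abs_le] at *
  constructor <;> linarith [h1.1, h1.2, h2.1, h2.2, h3.1, h3.2]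

/-- The homogeneous quasimorphism that counts the segments satisfying `P`, for a `G`-invariant
`P`. It has defect at most `6`. -/
theorem exists_countingQuasimorphism (hP : ∀ p, P p → p ≠ [])
    (hPG : ∀ (g : G) p, P p → P (p.map (g • ·))) :
    ∃ h : G → ℝ, IsHomogeneousQuasimorphism h 6 ∧
      ∀ g y, Tendsto (fun n : ℕ => hT.countDiff P y (g ^ n • y) / n) atTop (𝓝 (h g)) := by
  obtain ⟨x₀⟩ := hT.isTree.connected.nonempty
  have hf : IsAntisymmQuasimorphism (fun g : G => hT.countDiff P x₀ (g • x₀)) 3 := by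
    refine ⟨fun g => ?_, fun g h => ?_⟩
    · rw [← hT.countDiff_symm, ← hT.countDiff_smul hP hPG g x₀ (g⁻¹ • x₀), smul_inv_smul]
    · have h1 := hT.abs_countDiff_triangle_le hP x₀ (g • x₀) ((g * h) • x₀)
      rw [mul_smul, hT.countDiff_smul hP hPG, hT.countDiff_symm x₀ (g • h • x₀)] at h1
      rw [mul_smul]
      rw [abs_le] at *
      constructor <;> linarith [h1.1, h1.2]
  obtain ⟨h, hh, hlim⟩ := hf.exists_homogenization
  refine ⟨h, by convert hh using 1; norm_num, fun g y => ?_⟩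
  -- changing the base point changes the count by a bounded amount
  have hbound : ∀ n : ℕ, ‖hT.countDiff P y (g ^ n • y) - hT.countDiff P x₀ (g ^ n • x₀)‖ ≤ 6 := by
    intro n
    have h1 := hT.abs_countDiff_triangle_le hP y x₀ (g ^ n • y)
    have h2 := hT.abs_countDiff_triangle_le hP x₀ (g ^ n • x₀) (g ^ n • y)
    rw [hT.countDiff_smul hP hPG, hT.countDiff_symm x₀ (g ^ n • y)] at h2
    rw [hT.countDiff_symm y (g ^ n • y), hT.countDiff_symm x₀ y] at h1
    rw [Real.norm_eq_abs]
    rw [abs_le] at *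
    constructor <;> linarith [h1.1, h1.2, h2.1, h2.2]
  have hzero : Tendsto (fun n : ℕ => (hT.countDiff P y (g ^ n • y) -
      hT.countDiff P x₀ (g ^ n • x₀)) / n) atTop (𝓝 0) := by
    refine squeeze_zero_norm (fun n => ?_) (tendsto_const_div_atTop_nhds_zero_nat (6 : ℝ))
    rw [norm_div, RCLike.norm_natCast]
    gcongr
    exact hbound n
  simpa [← add_div] using hzero.add (hlim g)

end IsTreeAction

/-! ### Axes and their pointwise stabilizers -/

section Axis

variable {X : Type*} {Γ : SimpleGraph X} {G : Type*} [Group G] [MulAction G X]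

/-- `g` translates the line `ℓ` by `τ > 0`. -/
structure IsAxis (Γ : SimpleGraph X) (g : G) (τ : ℕ) (ℓ : ℤ → X) : Prop where
  pos : 0 < τ
  line : IsLine Γ ℓ
  smul : ∀ i, g • ℓ i = ℓ (i + τ)

/-- `g` translates the line `ℓ` by `τ > 0`, and commutes with all the elements that fix `ℓ`
pointwise. -/
structure IsCentralAxis (Γ : SimpleGraph X) (g : G) (τ : ℕ) (ℓ : ℤ → X) : Prop
    extends IsAxis Γ g τ ℓ where
  commute : ∀ k : G, (∀ i, k • ℓ i = ℓ i) → Commute k g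

namespace IsAxis

variable {g : G} {τ : ℕ} {ℓ : ℤ → X} (h : IsAxis Γ g τ ℓ)
include h

theorem inv_smul (i : ℤ) : g⁻¹ • ℓ i = ℓ (i - τ) := by
  rw [inv_smul_eq_iff, h.smul, sub_add_cancel]

theorem pow_smul (n : ℕ) (i : ℤ) : g ^ n • ℓ i = ℓ (i + n * τ) := by
  induction n with
  | zero => simp
  | succ n ih =>
    rw [pow_succ', mul_smul, ih, h.smul]
    congr 1
    push_cast
    ring

theorem zpow_smul (n : ℤ) (i : ℤ) : g ^ n • ℓ i = ℓ (i + n * τ) := by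
  obtain ⟨n, rfl | rfl⟩ := n.eq_nat_or_neg
  · rw [zpow_natCast, h.pow_smul]
  · rw [zpow_neg, zpow_natCast, inv_smul_eq_iff, h.pow_smul]
    congr 1
    ring

theorem smul_ne (hT : IsTreeAction G Γ) (i : ℤ) : g • ℓ i ≠ ℓ i := fun e => by
  have h1 := h.line.seg_eq hT.isTree i τ
  rw [← h.smul, e, hT.isTree.seg_eq SimpleGraph.Walk.IsPath.nil] at h1
  have := congrArg List.length h1
  simp only [SimpleGraph.Walk.darts_nil, List.map_nil, List.length_nil, List.length_map,
    List.length_range] at this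
  exact h.pos.ne this

theorem smul_eq_of_commute (hT : IsTreeAction G Γ) {k : G} (hk : Commute k g) {s : ℤ}
    (hs : k • ℓ s = ℓ s) (i : ℤ) : k • ℓ i = ℓ i := by
  have h1 : ∀ n : ℤ, k • ℓ (s + n * τ) = ℓ (s + n * τ) := fun n => by
    rw [← h.zpow_smul, smul_smul, (hk.zpow_right n).eq, mul_smul, hs]
  have h2 : (1 : ℤ) ≤ τ := by exact_mod_cast h.pos
  refine hT.smul_eq_of_between h.line ?_ ?_ (h1 (-|i - s|)) (h1 |i - s|)
  · have := neg_abs_le (i - s)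
    have := abs_nonneg (i - s)
    nlinarith
  · have := le_abs_self (i - s)
    have := abs_nonneg (i - s)
    nlinarith

/-- Every element with an axis is, up to an element that fixes the axis pointwise, an element which
commutes with the pointwise stabilizer of `D + 1` edges of the axis. -/
theorem exists_eq_mul (hT : IsTreeAction G Γ) {D : ℕ}
    (hB : ∀ x y, Γ.Adj x y → IsBCMS D (MulAction.stabilizer G x ⊓ MulAction.stabilizer G y)) :
    ∃ t c, g = t * c ∧ Commute t c ∧ (∀ i, c • ℓ i = ℓ i) ∧ IsAxis Γ t τ ℓ ∧
      ∀ k : G, (∀ j : ℕ, j ≤ D → k • ℓ (j * τ) = ℓ (j * τ) ∧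
        k • ℓ (j * τ + 1) = ℓ (j * τ + 1)) → Commute k t := by
  obtain ⟨t, c, hg, htc, hc, ht⟩ := (hB _ _ (h.line.adj 0)).exists_eq_mul (g := g)
    fun hmem => h.smul_ne hT 0 hmem.1
  have hcfix : ∀ i, c • ℓ i = ℓ i :=
    h.smul_eq_of_commute hT (k := c) (by rw [hg]; exact htc.symm.mul_right (Commute.refl c)) hc.1
  refine ⟨t, c, hg, htc, hcfix, ⟨h.pos, h.line, fun i => ?_⟩, fun k hk => ht k fun j hj => ?_⟩
  · rw [← h.smul, hg, mul_smul, hcfix]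
  · obtain ⟨h1, h2⟩ := hk j hj
    constructor
    · change ((g ^ j)⁻¹ * k * g ^ j) • ℓ 0 = ℓ 0
      rw [mul_smul, mul_smul, h.pow_smul, zero_add, h1, inv_smul_eq_iff, h.pow_smul, zero_add]
    · change ((g ^ j)⁻¹ * k * g ^ j) • ℓ (0 + 1) = ℓ (0 + 1)
      rw [mul_smul, mul_smul, h.pow_smul, zero_add, add_comm, h2, inv_smul_eq_iff, h.pow_smul,
        add_comm]

theorem exists_isCentralAxis (hT : IsTreeAction G Γ) {D : ℕ}
    (hB : ∀ x y, Γ.Adj x y → IsBCMS D (MulAction.stabilizer G x ⊓ MulAction.stabilizer G y)) :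
    ∃ t c, g = t * c ∧ Commute t c ∧ (∀ i, c • ℓ i = ℓ i) ∧ IsCentralAxis Γ t τ ℓ := by
  obtain ⟨t, c, hg, htc, hc, hax, ht⟩ := h.exists_eq_mul hT hB
  exact ⟨t, c, hg, htc, hc, hax, fun k hk => ht k fun j _ => ⟨hk _, hk _⟩⟩

/-- An element that fixes `D τ + 1` consecutive edges of an axis fixes the whole axis. -/
theorem smul_eq_of_fixes (hT : IsTreeAction G Γ) {D : ℕ}
    (hB : ∀ x y, Γ.Adj x y → IsBCMS D (MulAction.stabilizer G x ⊓ MulAction.stabilizer G y))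
    {k : G} (hk : ∀ i : ℤ, 0 ≤ i → i ≤ D * τ + 1 → k • ℓ i = ℓ i) (i : ℤ) : k • ℓ i = ℓ i := by
  obtain ⟨t, c, -, -, -, hax, ht⟩ := h.exists_eq_mul hT hB
  refine hax.smul_eq_of_commute hT (ht k fun j hj => ?_) (hk 0 le_rfl (by positivity)) i
  have h1 : (j * τ : ℤ) ≤ D * τ := by exact_mod_cast Nat.mul_le_mul_right _ hj
  have h2 : (0 : ℤ) ≤ j * τ := by positivity
  exact ⟨hk _ h2 (by omega), hk _ (by omega) (by omega)⟩

end IsAxis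

namespace IsCentralAxis

variable {g : G} {τ : ℕ} {ℓ : ℤ → X}

theorem shift (h : IsCentralAxis Γ g τ ℓ) (s : ℤ) : IsCentralAxis Γ g τ fun k => ℓ (s + k) where
  pos := h.pos
  line := h.line.shift s
  smul i := by rw [h.smul, add_assoc]
  commute k hk := h.commute k fun i => by simpa using hk (i - s)

theorem reflect (h : IsCentralAxis Γ g τ ℓ) (s : ℤ) :
    IsCentralAxis Γ g⁻¹ τ fun k => ℓ (s - k) where
  pos := h.pos
  line := h.line.reflect s
  smul i := by rw [h.inv_smul, sub_sub]
  commute k hk := (h.commute k fun i => by simpa using hk (s - i)).inv_right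

theorem conj (hT : IsTreeAction G Γ) (h : IsCentralAxis Γ g τ ℓ) (a : G) :
    IsCentralAxis Γ (a * g * a⁻¹) τ fun k => a • ℓ k where
  pos := h.pos
  line := hT.isLine_smul h.line a
  smul i := by rw [mul_smul, mul_smul, inv_smul_smul, h.smul]
  commute k hk := by
    have h1 := (h.commute (a⁻¹ * k * a) fun i => by
      rw [mul_smul, mul_smul, hk, inv_smul_smul]).eq
    change k * (a * g * a⁻¹) = a * g * a⁻¹ * k
    calc k * (a * g * a⁻¹) = a * (a⁻¹ * k * a * g) * a⁻¹ := by group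
      _ = a * (g * (a⁻¹ * k * a)) * a⁻¹ := by rw [h1]
      _ = a * g * a⁻¹ * k := by group

variable {x : G} {σ : ℕ} {ℓ' : ℤ → X} {D : ℕ} (hT : IsTreeAction G Γ)
  (hB : ∀ x y, Γ.Adj x y → IsBCMS D (MulAction.stabilizer G x ⊓ MulAction.stabilizer G y))
  (hg : IsCentralAxis Γ g τ ℓ) (hx : IsCentralAxis Γ x σ ℓ') (hστ : σ ≤ τ)
  (hℓ : ∀ k : ℤ, 0 ≤ k → k ≤ (D + 2) * τ → ℓ' k = ℓ k)
include hT hB hg hx hστ hℓ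

theorem commute_of_overlap {k : G} (hk : ∀ i, k • ℓ i = ℓ i) : Commute k x := by
  refine hx.commute k (hx.smul_eq_of_fixes hT hB fun i hi0 hi => ?_)
  have h1 : (D * σ : ℤ) ≤ D * τ := by exact_mod_cast Nat.mul_le_mul_left _ hστ
  have h2 : (0 : ℤ) < τ := by exact_mod_cast hg.pos
  rw [hℓ i hi0 (by linarith), hk]

/-- If the axes of `g` and `x` share a segment of length `(D + 2) τ`, where `τ` is the larger
translation length, then `x` translates the axis of `g`: the commutator of `x` and `g` (or `g⁻¹ x`,
when the two translation lengths agree) fixes so many edges of the axis of `g` that it fixes this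
axis. -/
theorem smul_of_overlap (i : ℤ) : x • ℓ i = ℓ (i + σ) := by
  have hτ : (0 : ℤ) < τ := by exact_mod_cast hg.pos
  have hσ : (0 : ℤ) < σ := by exact_mod_cast hx.pos
  have hστ' : (σ : ℤ) ≤ τ := by exact_mod_cast hστ
  have hDτ : (0 : ℤ) ≤ D * τ := by positivity
  have hxℓ : ∀ i : ℤ, 0 ≤ i → i + σ ≤ (D + 2) * τ → x • ℓ i = ℓ (i + σ) := fun i h0 h1 => by
    rw [← hℓ i h0 (by linarith), hx.smul, hℓ _ (by linarith) h1]
  rcases hστ.lt_or_eq with hlt | heq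
  · have hlt' : (σ : ℤ) + 1 ≤ τ := by exact_mod_cast hlt
    have hu : ∀ i, (g⁻¹ * x⁻¹ * g * x) • ℓ i = ℓ i := by
      refine hg.smul_eq_of_fixes hT hB fun i h0 h1 => ?_
      rw [mul_smul, mul_smul, mul_smul, hxℓ i h0 (by linarith), hg.smul, inv_smul_eq_iff,
        inv_smul_eq_iff, hg.smul, hxℓ _ (by linarith) (by linarith)]
      congr 1
      ring
    set u := g⁻¹ * x⁻¹ * g * x with hu_def
    have hxg : x * g * u = g * x := by rw [hu_def]; group
    have hgx : ∀ j, x • g • ℓ j = g • x • ℓ j := fun j => by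
      rw [smul_smul, smul_smul, ← hxg, mul_smul (x * g) u, hu]
    have hstep : ∀ i, x • ℓ i = ℓ (i + σ) ↔ x • ℓ (i + τ) = ℓ (i + τ + σ) := fun i => by
      rw [← hg.smul, hgx, add_right_comm, ← hg.smul]
      exact (MulAction.injective g).eq_iff.symm
    have hmul : ∀ n : ℕ, ∀ i, x • ℓ i = ℓ (i + σ) ↔ x • ℓ (i + n * τ) = ℓ (i + n * τ + σ) := by
      intro n
      induction n with
      | zero => simp
      | succ n ih =>
        intro i
        rw [ih, hstep, add_assoc i]
        push_cast
        rw [add_mul, one_mul]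
    have hbase : ∀ q : ℤ, x • ℓ (i % τ + q * τ) = ℓ (i % τ + q * τ + σ) := fun q => by
      have h0 := hxℓ (i % τ) (Int.emod_nonneg _ hτ.ne')
        (by have := Int.emod_lt_of_pos i hτ; linarith)
      obtain ⟨n, rfl | rfl⟩ := q.eq_nat_or_neg
      · exact (hmul n _).1 h0
      · rw [hmul n, neg_mul, neg_add_cancel_right]
        exact h0
    have h1 := hbase (i / τ)
    rwa [mul_comm, Int.emod_add_mul_ediv] at h1
  · have hk : ∀ i, (g⁻¹ * x) • ℓ i = ℓ i := by
      refine hg.smul_eq_of_fixes hT hB fun i h0 h1 => ?_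
      rw [mul_smul, hxℓ i h0 (by linarith), inv_smul_eq_iff, hg.smul, heq]
    have h1 := hk i
    rwa [mul_smul, inv_smul_eq_iff, hg.smul, ← heq] at h1

/-- If the axes of `g` and `x` share a segment of length `(D + 2) τ`, where `τ` is the larger
translation length, then `g` and `x` are, up to elements with fixed points, powers of the same
element `y`, which translates by the greatest common divisor of the translation lengths. -/
theorem exists_common_root_of_overlap :
    ∃ (y : G) (d : ℕ) (a b : ℤ) (k₁ k₂ : G), IsAxis Γ y d ℓ ∧
      (∀ i, k₁ • ℓ i = ℓ i) ∧ (∀ i, k₂ • ℓ i = ℓ i) ∧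
      chainClass g = a • chainClass y + chainClass k₁ ∧
      chainClass x = b • chainClass y + chainClass k₂ := by
  have hxax : IsAxis Γ x σ ℓ :=
    ⟨hx.pos, hg.line, smul_of_overlap hT hB hg hx hστ hℓ⟩
  set d := Nat.gcd σ τ with hd
  set y := x ^ Nat.gcdA σ τ * g ^ Nat.gcdB σ τ with hy
  have hyax : IsAxis Γ y d ℓ := by
    refine ⟨Nat.gcd_pos_of_pos_left _ hx.pos, hg.line, fun i => ?_⟩
    rw [hy, mul_smul, hg.zpow_smul, hxax.zpow_smul, hd, Nat.gcd_eq_gcd_ab]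
    congr 1
    ring
  have hcomm : ∀ k : G, (∀ i, k • ℓ i = ℓ i) → Commute y k := fun k hk =>
    (((commute_of_overlap hT hB hg hx hστ hℓ hk).zpow_right _).mul_right
      ((hg.commute k hk).zpow_right _)).symm
  -- an element which translates `ℓ` by a multiple of `d` is a power of `y` up to an element
  -- fixing `ℓ`
  have key : ∀ z n, IsAxis Γ z n ℓ → d ∣ n → ∃ (a : ℤ) (k : G), (∀ i, k • ℓ i = ℓ i) ∧
      chainClass z = a • chainClass y + chainClass k := by
    rintro z n hz ⟨a, rfl⟩
    have hk : ∀ i, ((y ^ a)⁻¹ * z) • ℓ i = ℓ i := fun i => by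
      rw [mul_smul, hz.smul, inv_smul_eq_iff, hyax.pow_smul]
      congr 1
      push_cast
      ring
    refine ⟨a, (y ^ a)⁻¹ * z, hk, ?_⟩
    have h1 := chainClass_mul ((hcomm _ hk).pow_left a)
    rw [mul_inv_cancel_left] at h1
    rw [h1, ← zpow_natCast, chainClass_zpow]
  obtain ⟨a, k₁, hk₁, h₁⟩ := key g τ hg.toIsAxis (Nat.gcd_dvd_right _ _)
  obtain ⟨b, k₂, hk₂, h₂⟩ := key x σ hxax (Nat.gcd_dvd_left _ _)
  exact ⟨y, d, a, b, k₁, k₂, hyax, hk₁, hk₂, h₁, h₂⟩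

end IsCentralAxis

/-- A reflection of a line fixes a vertex, since there are no inversions. -/
theorem IsTreeAction.exists_fixed_of_reflect (hT : IsTreeAction G Γ) {ℓ : ℤ → X}
    (h : IsLine Γ ℓ) {a : G} {s : ℤ} (ha : ∀ i, a • ℓ i = ℓ (s - i)) : ∃ y : X, a • y = y := by
  obtain ⟨m, rfl | rfl⟩ := Int.even_or_odd' s
  · refine ⟨ℓ m, ?_⟩
    rw [ha]
    congr 1
    ring
  · refine absurd ?_ (hT.no_inversion a (h.adj m) ?_)
    · rw [ha]
      congr 1
      ring
    · rw [ha]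
      congr 1
      ring

/-- If a long segment of the axis of `g` occurs with the opposite direction in the axis of `g`, then
`g` is equivalent to an integral chain of elements with fixed points: `g` acts on its axis as the
product of two reflections. -/
theorem IsCentralAxis.chainClass_eq_of_reflect {g : G} {τ : ℕ} {ℓ : ℤ → X} {D : ℕ}
    (hT : IsTreeAction G Γ)
    (hB : ∀ x y, Γ.Adj x y → IsBCMS D (MulAction.stabilizer G x ⊓ MulAction.stabilizer G y))
    (hg : IsCentralAxis Γ g τ ℓ) {a : G} {s : ℤ}
    (ha : ∀ k : ℤ, 0 ≤ k → k ≤ (D + 2) * τ → ℓ (s - k) = a • ℓ k) :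
    ∃ u v : G, (∃ y : X, u • y = y) ∧ (∃ y : X, v • y = y) ∧
      chainClass g = chainClass u - chainClass v := by
  have hx := (hg.reflect s).conj hT a⁻¹
  have hxℓ := hg.smul_of_overlap hT hB hx le_rfl fun k h0 h1 => by
    rw [ha k h0 h1, inv_smul_smul]
  rw [inv_inv] at hxℓ
  have hτ : (0 : ℤ) < τ := by exact_mod_cast hg.pos
  have hstep : ∀ i, a • ℓ i = ℓ (s - i) ↔ a • ℓ (i + τ) = ℓ (s - (i + τ)) := fun i => by
    rw [← hxℓ, mul_smul, mul_smul, smul_inv_smul, ← sub_sub, ← hg.inv_smul]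
    exact (MulAction.injective g⁻¹).eq_iff.symm
  have hmul : ∀ n : ℕ, ∀ i, a • ℓ i = ℓ (s - i) ↔ a • ℓ (i + n * τ) = ℓ (s - (i + n * τ)) := by
    intro n
    induction n with
    | zero => simp
    | succ n ih =>
      intro i
      rw [ih, hstep, add_assoc i]
      push_cast
      rw [add_mul, one_mul]
  have haℓ : ∀ i, a • ℓ i = ℓ (s - i) := fun i => by
    have hDτ : (0 : ℤ) ≤ D * τ := by positivity
    have h0 := (ha (i % τ) (Int.emod_nonneg _ hτ.ne')
      (by have := Int.emod_lt_of_pos i hτ; linarith)).symm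
    have hq : ∀ q : ℤ, a • ℓ (i % τ + q * τ) = ℓ (s - (i % τ + q * τ)) := fun q => by
      obtain ⟨n, rfl | rfl⟩ := q.eq_nat_or_neg
      · exact (hmul n _).1 h0
      · rw [hmul n, neg_mul, neg_add_cancel_right]
        exact h0
    have h1 := hq (i / τ)
    rwa [mul_comm, Int.emod_add_mul_ediv] at h1
  have hga : ∀ i, (g * a) • ℓ i = ℓ (s + τ - i) := fun i => by
    rw [mul_smul, haℓ, hg.smul]
    congr 1
    ring
  have c1 : Commute (a * a) g := hg.commute _ fun i => by
    rw [mul_smul, haℓ, haℓ]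
    congr 1
    ring
  have c2 : Commute (g * a * (g * a)) g := hg.commute _ fun i => by
    rw [mul_smul, hga, hga]
    congr 1
    ring
  refine ⟨g * a, a, hT.exists_fixed_of_reflect hg.line hga,
    hT.exists_fixed_of_reflect hg.line haℓ, ?_⟩
  -- `a g a⁻¹ = g⁻¹ (g a)² a⁻²`, where the factors on the right commute
  have e : a * g * a⁻¹ = g⁻¹ * (g * a * (g * a) * (a * a)⁻¹) := by group
  have c3 : Commute (g * a * (g * a)) (a * a)⁻¹ := by
    have h1 : Commute (g * a) (a * a) :=
      c1.symm.mul_left ((Commute.refl a).mul_right (Commute.refl a))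
    exact (h1.mul_left h1).inv_right
  have h1 := congrArg chainClass e
  rw [chainClass_conj, chainClass_mul (c2.mul_left c1.inv_left).symm.inv_left, chainClass_mul c3,
    chainClass_inv, chainClass_inv, chainClass_mul (Commute.refl _),
    chainClass_mul (Commute.refl _)] at h1
  refine smul_right_injective _ (two_ne_zero (α := ℝ)) ?_
  simp only [two_smul]
  nth_rw 1 [h1]
  abel

end Axis

/-! ### The gap theorem for actions on trees -/

section Gap

variable {X : Type*} {Γ : SimpleGraph X} {G : Type*} [Group G] [MulAction G X]

/-- The segment of length `n` which starts at the origin of the line `ℓ`, as a list of oriented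
edges. -/
def lineSegment (ℓ : ℤ → X) (n : ℕ) : List (X × X) :=
  (List.range n).map fun k : ℕ => (ℓ k, ℓ (k + 1))

/-- The translates under `G` of the segment of length `n` of the line `ℓ`. -/
def IsTranslate (G : Type*) [Group G] [MulAction G X] (ℓ : ℤ → X) (n : ℕ) (p : List (X × X)) :
    Prop :=
  ∃ a : G, p = (lineSegment ℓ n).map (a • ·)

theorem IsTranslate.ne_nil {ℓ : ℤ → X} {n : ℕ} (hn : 0 < n) {p : List (X × X)}
    (h : IsTranslate G ℓ n p) : p ≠ [] := by
  obtain ⟨a, rfl⟩ := h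
  simp [lineSegment, hn.ne']

theorem IsTranslate.map_smul {ℓ : ℤ → X} {n : ℕ} (g : G) {p : List (X × X)}
    (h : IsTranslate G ℓ n p) : IsTranslate G ℓ n (p.map (g • ·)) := by
  obtain ⟨a, rfl⟩ := h
  refine ⟨g * a, ?_⟩
  rw [List.map_map]
  refine List.map_congr_left fun q _ => ?_
  simp [mul_smul]

theorem IsLine.exists_of_isTranslate_infix {ℓ ℓ' : ℤ → X} {n m : ℕ} (hn : 0 < n) {i : ℤ}
    {p : List (X × X)} (hp : IsTranslate G ℓ n p)
    (h : p <:+: (List.range m).map fun k : ℕ => (ℓ' (i + k), ℓ' (i + k + 1))) :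
    ∃ (a : G) (s : ℤ), ∀ k : ℤ, 0 ≤ k → k ≤ n → ℓ' (s + k) = a • ℓ k := by
  obtain ⟨a, rfl⟩ := hp
  obtain ⟨l₁, l₂, hl⟩ := h
  have hk : ∀ k : ℕ, k < n → ℓ' (i + l₁.length + k) = a • ℓ k ∧
      ℓ' (i + l₁.length + k + 1) = a • ℓ (k + 1) := by
    intro k hk
    have h1 := congrArg (fun l : List (X × X) => l[l₁.length + k]?) hl
    have hlen := congrArg List.length hl
    simp only [List.length_append, List.length_map, lineSegment, List.length_range] at hlen
    have hlt : l₁.length + k < m := by omega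
    rw [List.append_assoc] at h1
    simp only [List.getElem?_append_right (Nat.le_add_right _ _), Nat.add_sub_cancel_left] at h1
    rw [List.getElem?_append_left (by simpa [lineSegment] using hk)] at h1
    simp only [lineSegment, List.getElem?_map, List.getElem?_range hk, List.getElem?_range hlt,
      Option.map_some, Option.some.injEq, Prod.smul_mk, Prod.mk.injEq] at h1
    push_cast at h1
    rw [add_assoc i]
    exact ⟨h1.1.symm, h1.2.symm⟩
  refine ⟨a, i + l₁.length, fun k h0 h1 => ?_⟩
  obtain ⟨k, rfl⟩ := Int.eq_ofNat_of_zero_le h0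
  rcases Nat.lt_or_ge k n with hkn | hkn
  · exact (hk k hkn).1
  · have hkn' : k = (k - 1) + 1 := by omega
    have := (hk (k - 1) (by omega)).2
    rw [hkn']
    push_cast
    rwa [← add_assoc]

theorem IsLine.packCount_seg_eq_zero (hT : IsTreeAction G Γ) {ℓ ℓ' : ℤ → X} (hℓ' : IsLine Γ ℓ')
    {n : ℕ} (hn : 0 < n)
    (h : ∀ (a : G) (s : ℤ), ¬∀ k : ℤ, 0 ≤ k → k ≤ n → ℓ' (s + k) = a • ℓ k) (i : ℤ) (m : ℕ) :
    packCount (IsTranslate G ℓ n) (hT.isTree.seg (ℓ' i) (ℓ' (i + m))) = 0 := by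
  refine packCount_eq_zero (fun p hp => hp.ne_nil hn) fun p hp hinf => ?_
  rw [hℓ'.seg_eq] at hinf
  obtain ⟨a, s, has⟩ := IsLine.exists_of_isTranslate_infix hn hp hinf
  exact h a s has

theorem IsLine.packCount_seg_reverse_eq_zero (hT : IsTreeAction G Γ) {ℓ ℓ' : ℤ → X}
    (hℓ' : IsLine Γ ℓ') {n : ℕ} (hn : 0 < n)
    (h : ∀ (a : G) (s : ℤ), ¬∀ k : ℤ, 0 ≤ k → k ≤ n → ℓ' (s - k) = a • ℓ k) (i : ℤ) (m : ℕ) :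
    packCount (IsTranslate G ℓ n) (hT.isTree.seg (ℓ' (i + m)) (ℓ' i)) = 0 := by
  have := (hℓ'.reflect (i + m)).packCount_seg_eq_zero hT hn (ℓ := ℓ)
    (fun a s hs => h a (i + m - s) fun k h0 h1 => by rw [← hs k h0 h1, sub_sub]) 0 m
  simpa using this

/-- The axis of `g` contains `m` disjoint translates of its segment of length `N τ` along `m N`
translations. -/
theorem IsAxis.le_packCount (hT : IsTreeAction G Γ) {g : G} {τ : ℕ} {ℓ : ℤ → X}
    (h : IsAxis Γ g τ ℓ) {N : ℕ} (hN : 0 < N) (m : ℕ) :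
    m ≤ packCount (IsTranslate G ℓ (N * τ)) (hT.isTree.seg (ℓ 0) (ℓ (0 + (m * (N * τ) : ℕ)))) := by
  refine Packs.le_packCount (fun p hp => hp.ne_nil (Nat.mul_pos hN h.pos)) ?_
  rw [h.line.seg_eq]
  induction m with
  | zero => exact .zero _
  | succ m ih =>
    rw [add_mul, one_mul, List.range_add, List.map_append]
    refine ih.append ?_
    have : Packs (IsTranslate G ℓ (N * τ)) (0 + 1)
        ([] ++ ((List.map (fun k : ℕ => (ℓ (0 + k), ℓ (0 + k + 1)))
          (List.map (fun x => m * (N * τ) + x) (List.range (N * τ)))) ++ [])) := by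
      refine .succ _ ⟨g ^ (m * N), ?_⟩ (.zero _)
      rw [lineSegment, List.map_map, List.map_map]
      refine List.map_congr_left fun k _ => ?_
      simp only [Function.comp_apply, Prod.smul_mk, h.pow_smul]
      push_cast
      congr 2 <;> ring
    simpa using this

/-- A term `coeff · elem` of a chain, together with a line and a length. That `elem` translates the
line by `len` is imposed separately, by `IsAxis` or `IsCentralAxis`. -/
structure AxialTerm (X G : Type*) where
  coeff : ℤ
  elem : G
  len : ℕ
  line : ℤ → X

/-- The class of the chain `∑ coeff · elem`. -/
noncomputable def axialSum (L : List (AxialTerm X G)) : ChainSpace G :=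
  (L.map fun t => t.coeff • chainClass t.elem).sum

omit [MulAction G X] in
theorem axialSum_append_cons (A B : List (AxialTerm X G)) (t : AxialTerm X G) :
    axialSum (A ++ t :: B) = t.coeff • chainClass t.elem + axialSum (A ++ B) := by
  simp only [axialSum, List.map_append, List.map_cons, List.sum_append, List.sum_cons]
  abel

/-- The elements with a fixed point. -/
def ellipticSet (X G : Type*) [Group G] [MulAction G X] : Set G := {g | ∃ y : X, g • y = y}

theorem chainClass_mem_of_fixes {k : G} {ℓ : ℤ → X} (hk : ∀ i, k • ℓ i = ℓ i) :
    chainClass k ∈ chainSpan (ellipticSet X G) :=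
  chainClass_mem_chainSpan ⟨ℓ 0, hk 0⟩

theorem exists_axialSum_central (hT : IsTreeAction G Γ) {D : ℕ}
    (hB : ∀ x y, Γ.Adj x y → IsBCMS D (MulAction.stabilizer G x ⊓ MulAction.stabilizer G y))
    (L : List (AxialTerm X G)) (hL : ∀ t ∈ L, IsAxis Γ t.elem t.len t.line) :
    ∃ L' : List (AxialTerm X G), L'.length = L.length ∧
      (∀ t ∈ L', IsCentralAxis Γ t.elem t.len t.line) ∧
      axialSum L - axialSum L' ∈ chainSpan (ellipticSet X G) := by
  induction L with
  | nil => exact ⟨[], rfl, by simp, by simp⟩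
  | cons t L ih =>
    obtain ⟨L', hlen, hL', hsum⟩ := ih fun t ht => hL t (List.mem_cons_of_mem _ ht)
    obtain ⟨r, c, hg, hrc, hc, hr⟩ := (hL t List.mem_cons_self).exists_isCentralAxis hT hB
    refine ⟨⟨t.coeff, r, t.len, t.line⟩ :: L', by simp [hlen], ?_, ?_⟩
    · rintro t' (_ | ⟨_, ht'⟩)
      exacts [hr, hL' t' ht']
    · have e : axialSum (t :: L) - axialSum (⟨t.coeff, r, t.len, t.line⟩ :: L') =
          t.coeff • chainClass c + (axialSum L - axialSum L') := by
        simp only [axialSum, List.map_cons, List.sum_cons]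
        rw [hg, chainClass_mul hrc, smul_add]
        abel
      rw [e]
      exact add_mem (zsmul_mem (chainClass_mem_of_fixes hc) _) hsum

/-- Two terms whose axes share a long segment, up to translation, can be replaced by a single
term. -/
theorem exists_merge (hT : IsTreeAction G Γ) {D : ℕ}
    (hB : ∀ x y, Γ.Adj x y → IsBCMS D (MulAction.stabilizer G x ⊓ MulAction.stabilizer G y))
    {g x : G} {τ σ : ℕ} {ℓ ℓ' : ℤ → X} (hg : IsCentralAxis Γ g τ ℓ) (hx : IsCentralAxis Γ x σ ℓ')
    (hστ : σ ≤ τ)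
    (h : (∃ (a : G) (s : ℤ), ∀ k : ℤ, 0 ≤ k → k ≤ (D + 2) * τ → ℓ' (s + k) = a • ℓ k) ∨
      ∃ (a : G) (s : ℤ), ∀ k : ℤ, 0 ≤ k → k ≤ (D + 2) * τ → ℓ' (s - k) = a • ℓ k) (n m : ℤ) :
    ∃ t : AxialTerm X G, IsAxis Γ t.elem t.len t.line ∧
      n • chainClass g + m • chainClass x - t.coeff • chainClass t.elem ∈
        chainSpan (ellipticSet X G) := by
  have key : ∀ (x : G) (ℓ' : ℤ → X) (m : ℤ), IsCentralAxis Γ x σ ℓ' →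
      (∃ (a : G) (s : ℤ), ∀ k : ℤ, 0 ≤ k → k ≤ (D + 2) * τ → ℓ' (s + k) = a • ℓ k) →
      ∃ t : AxialTerm X G, IsAxis Γ t.elem t.len t.line ∧
        n • chainClass g + m • chainClass x - t.coeff • chainClass t.elem ∈
          chainSpan (ellipticSet X G) := by
    rintro x ℓ' m hx ⟨a, s, has⟩
    obtain ⟨y, d, p, q, k₁, k₂, hy, hk₁, hk₂, h₁, h₂⟩ :=
      hg.exists_common_root_of_overlap hT hB ((hx.shift s).conj hT a⁻¹) hστ fun k h0 h1 => by
        rw [has k h0 h1, inv_smul_smul]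
    rw [chainClass_conj] at h₂
    refine ⟨⟨n * p + m * q, y, d, ℓ⟩, hy, ?_⟩
    have e : n • chainClass g + m • chainClass x - (n * p + m * q) • chainClass y =
        n • chainClass k₁ + m • chainClass k₂ := by
      rw [h₁, h₂]
      simp only [smul_add, add_smul, mul_smul]
      abel
    simp only
    rw [e]
    exact add_mem (zsmul_mem (chainClass_mem_of_fixes hk₁) _)
      (zsmul_mem (chainClass_mem_of_fixes hk₂) _)
  rcases h with h | ⟨a, s, has⟩
  · exact key x ℓ' m hx h
  · obtain ⟨t, ht, h⟩ := key x⁻¹ (fun k => ℓ' (s - k)) (-m) (hx.reflect s)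
      ⟨a, 0, fun k h0 h1 => by rw [zero_add]; exact has k h0 h1⟩
    refine ⟨t, ht, ?_⟩
    rwa [chainClass_inv, neg_smul, smul_neg, neg_neg] at h

/-- If no long segment of the axis of `g` occurs in the axes of the other terms, nor backwards in
its own axis, then the quasimorphism that counts translates of this segment bounds `scl`. -/
theorem le_scl_of_no_overlap (hT : IsTreeAction G Γ) {N : ℕ} (hN : 0 < N) (c : IntegralChain G)
    {t : AxialTerm X G} {M : List (AxialTerm X G)} (ht0 : t.coeff ≠ 0)
    (ht : IsAxis Γ t.elem t.len t.line) (hM : ∀ t' ∈ M, IsAxis Γ t'.elem t'.len t'.line)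
    (hsum : (chainRelations G).mkQ c.toReal - (t.coeff • chainClass t.elem + axialSum M) ∈
      chainSpan (ellipticSet X G))
    (hself : ∀ (a : G) (s : ℤ),
      ¬∀ k : ℤ, 0 ≤ k → k ≤ (N * t.len : ℕ) → t.line (s - k) = a • t.line k)
    (hoverlap : ∀ t' ∈ M, ∀ (a : G) (s : ℤ),
      ¬∀ k : ℤ, 0 ≤ k → k ≤ (N * t.len : ℕ) → t'.line (s + k) = a • t.line k)
    (hoverlap' : ∀ t' ∈ M, ∀ (a : G) (s : ℤ),
      ¬∀ k : ℤ, 0 ≤ k → k ≤ (N * t.len : ℕ) → t'.line (s - k) = a • t.line k) :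
    ENNReal.ofReal (1 / (12 * N)) ≤ scl c := by
  have hpos : 0 < N * t.len := Nat.mul_pos hN ht.pos
  obtain ⟨h, hh, hlim⟩ := hT.exists_countingQuasimorphism (P := IsTranslate G t.line (N * t.len))
    (fun p hp => hp.ne_nil hpos) (fun g p hp => hp.map_smul g)
  obtain ⟨φ, hφ⟩ := hh.exists_linearMap
  have hzero : ∀ g (y : X), (∀ n : ℕ, hT.countDiff (IsTranslate G t.line (N * t.len)) y
      (g ^ n • y) = 0) → h g = 0 := fun g y hy =>
    tendsto_nhds_unique (hlim g y) (by simp [hy])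
  have hell : ∀ q ∈ chainSpan (ellipticSet X G), φ q = 0 := fun q hq => by
    induction hq using AddSubgroup.closure_induction with
    | mem q hq =>
      obtain ⟨g, ⟨y, hy⟩, rfl⟩ := hq
      rw [hφ]
      refine hzero g y fun n => ?_
      have : g ^ n • y = y := by
        induction n with
        | zero => simp
        | succ n ih => rw [pow_succ, mul_smul, hy, ih]
      simp [this, IsTreeAction.countDiff]
    | zero => simp
    | add a b _ _ ha hb => rw [map_add, ha, hb, add_zero]
    | neg a _ ha => rw [map_neg, ha, neg_zero]
  have hMzero : φ (axialSum M) = 0 := by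
    rw [axialSum, map_list_sum, List.map_map]
    refine List.sum_eq_zero fun r hr => ?_
    obtain ⟨t', ht', rfl⟩ := List.mem_map.1 hr
    have : h t'.elem = 0 := hzero _ (t'.line 0) fun n => by
      have e : (n * t'.len : ℤ) = (n * t'.len : ℕ) := by push_cast; rfl
      rw [(hM t' ht').pow_smul, IsTreeAction.countDiff, e,
        (hM t' ht').line.packCount_seg_eq_zero hT hpos (hoverlap t' ht'),
        (hM t' ht').line.packCount_seg_reverse_eq_zero hT hpos (hoverlap' t' ht')]
      simp
    simp [map_zsmul, hφ, this]
  have hNpos : (0 : ℝ) < N := Nat.cast_pos.2 hN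
  have htl : 1 / (N : ℝ) ≤ h t.elem := by
    have h1 : Filter.Tendsto (fun m : ℕ => (m + 1) * N) Filter.atTop Filter.atTop :=
      (Filter.tendsto_id.atTop_mul_const' hN).comp (Filter.tendsto_add_atTop_nat 1)
    refine ge_of_tendsto' ((hlim t.elem (t.line 0)).comp h1) fun m => ?_
    have e : (((m + 1) * N : ℕ) * t.len : ℤ) = ((m + 1) * (N * t.len) : ℕ) := by
      push_cast
      ring
    have h2 := ht.le_packCount hT hN (m + 1)
    rw [Function.comp_apply, ht.pow_smul, IsTreeAction.countDiff, e,
      ht.line.packCount_seg_reverse_eq_zero hT hpos hself, Nat.cast_zero, sub_zero,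
      div_le_div_iff₀ hNpos (by positivity), one_mul]
    push_cast
    gcongr
    exact_mod_cast h2
  have hval : Finsupp.linearCombination ℤ h c = t.coeff * h t.elem := by
    have h1 := hell _ hsum
    rw [map_sub, map_add, hMzero, map_zsmul, hφ, add_zero, sub_eq_zero, zsmul_eq_mul] at h1
    rw [← map_mkQ_toReal φ hφ, h1]
  refine hh.le_scl (by norm_num) c ?_
  rw [hval, abs_mul]
  have h1 : (1 : ℝ) ≤ |(t.coeff : ℝ)| := by
    rw [← Int.cast_abs]
    exact_mod_cast Int.one_le_abs ht0
  have h2 : 1 / (N : ℝ) ≤ |h t.elem| := htl.trans (le_abs_self _)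
  calc 2 * 6 * (1 / (12 * (N : ℝ))) = 1 * (1 / N) := by field_simp; norm_num
    _ ≤ _ := mul_le_mul h1 h2 (by positivity) (by positivity)

/-- The gap theorem for an action on a tree whose edge stabilizers are BCMS-`D`. The proof is by
induction on the number of terms without fixed points. -/
theorem IsTreeAction.mem_chainSpan_or_le_scl (hT : IsTreeAction G Γ) {D : ℕ}
    (hB : ∀ x y, Γ.Adj x y → IsBCMS D (MulAction.stabilizer G x ⊓ MulAction.stabilizer G y))
    (c : IntegralChain G) :
    (chainRelations G).mkQ c.toReal ∈ chainSpan (ellipticSet X G) ∨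
      ENNReal.ofReal (1 / (12 * (D + 2 : ℕ))) ≤ scl c := by
  have key : ∀ (n : ℕ) (L : List (AxialTerm X G)), L.length = n →
      (∀ t ∈ L, IsAxis Γ t.elem t.len t.line) →
      (chainRelations G).mkQ c.toReal - axialSum L ∈ chainSpan (ellipticSet X G) →
      (chainRelations G).mkQ c.toReal ∈ chainSpan (ellipticSet X G) ∨
        ENNReal.ofReal (1 / (12 * (D + 2 : ℕ))) ≤ scl c := by
    intro n
    induction n using Nat.strong_induction_on with
    | _ n ih =>
    intro L₀ hlen₀ hL₀ hsum₀
    obtain ⟨L, hlen, hL, hsumL⟩ := exists_axialSum_central hT hB L₀ hL₀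
    have hsum := add_mem hsum₀ hsumL
    rw [sub_add_sub_cancel] at hsum
    rw [hlen₀] at hlen
    rcases eq_or_ne L [] with rfl | hne
    · left
      simpa [axialSum] using hsum
    obtain ⟨t, htL, hmax⟩ := Set.exists_max_image {t | t ∈ L} AxialTerm.len L.finite_toSet
      (List.exists_mem_of_ne_nil L hne)
    obtain ⟨A, B, rfl⟩ := List.append_of_mem htL
    rw [axialSum_append_cons] at hsum
    have hmem : ∀ t' ∈ A ++ B, t' ∈ A ++ t :: B := fun t' ht' => by
      rw [List.mem_append] at ht' ⊢
      exact ht'.imp_right (List.mem_cons_of_mem _)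
    simp only [List.length_append, List.length_cons] at hlen
    -- a term whose class comes from elements with fixed points can be dropped
    have hdrop : t.coeff • chainClass t.elem ∈ chainSpan (ellipticSet X G) →
        (chainRelations G).mkQ c.toReal ∈ chainSpan (ellipticSet X G) ∨
          ENNReal.ofReal (1 / (12 * (D + 2 : ℕ))) ≤ scl c := fun hdrop => by
      refine ih (A ++ B).length (by rw [List.length_append]; omega) (A ++ B) rfl
        (fun t' ht' => (hL t' (hmem t' ht')).toIsAxis) ?_
      have := add_mem hsum hdrop
      rwa [← sub_sub, sub_right_comm, sub_add_cancel] at this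
    by_cases ht0 : t.coeff = 0
    · exact hdrop (by rw [ht0, zero_smul]; exact zero_mem _)
    have ht := hL t htL
    by_cases hself : ∃ (a : G) (s : ℤ), ∀ k : ℤ, 0 ≤ k → k ≤ (D + 2) * t.len →
        t.line (s - k) = a • t.line k
    · obtain ⟨a, s, has⟩ := hself
      obtain ⟨u, v, hu, hv, huv⟩ := ht.chainClass_eq_of_reflect hT hB has
      refine hdrop (zsmul_mem ?_ _)
      rw [huv]
      exact sub_mem (chainClass_mem_chainSpan hu) (chainClass_mem_chainSpan hv)
    by_cases hover : ∃ t' ∈ A ++ B,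
        (∃ (a : G) (s : ℤ), ∀ k : ℤ, 0 ≤ k → k ≤ (D + 2) * t.len →
          t'.line (s + k) = a • t.line k) ∨
        ∃ (a : G) (s : ℤ), ∀ k : ℤ, 0 ≤ k → k ≤ (D + 2) * t.len →
          t'.line (s - k) = a • t.line k
    · obtain ⟨t', ht', hover⟩ := hover
      obtain ⟨r, hr, hrsum⟩ := exists_merge hT hB ht (hL t' (hmem t' ht'))
        (hmax t' (hmem t' ht')) hover t.coeff t'.coeff
      obtain ⟨A', B', hAB⟩ := List.append_of_mem ht'
      have hlenAB := congrArg List.length hAB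
      simp only [List.length_append, List.length_cons] at hlenAB
      have hmem' : ∀ t'' ∈ A' ++ B', t'' ∈ A ++ B := fun t'' ht'' => by
        rw [hAB]
        rw [List.mem_append] at ht'' ⊢
        exact ht''.imp_right (List.mem_cons_of_mem _)
      refine ih (r :: (A' ++ B')).length (by simp only [List.length_append, List.length_cons]; omega)
        (r :: (A' ++ B')) rfl ?_ ?_
      · rintro t'' (_ | ⟨_, ht''⟩)
        exacts [hr, (hL t'' (hmem t'' (hmem' t'' ht''))).toIsAxis]
      · have h1 := add_mem hsum hrsum
        rw [hAB, axialSum_append_cons] at h1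
        have h2 := axialSum_append_cons [] (A' ++ B') r
        simp only [List.nil_append] at h2
        rw [h2]
        convert h1 using 1
        abel
    · right
      push Not at hself hover
      have ecast : (((D + 2) * t.len : ℕ) : ℤ) = (D + 2) * t.len := by push_cast; rfl
      refine le_scl_of_no_overlap hT (by omega) c ht0 ht.toIsAxis
        (fun t' ht' => (hL t' (hmem t' ht')).toIsAxis) hsum ?_ ?_ ?_
      · intro a s has
        rw [ecast] at has
        obtain ⟨k, h0, h1, h2⟩ := hself a s
        exact h2 (has k h0 h1)
      · intro t' ht' a s has
        rw [ecast] at has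
        obtain ⟨k, h0, h1, h2⟩ := (hover t' ht').1 a s
        exact h2 (has k h0 h1)
      · intro t' ht' a s has
        rw [ecast] at has
        obtain ⟨k, h0, h1, h2⟩ := (hover t' ht').2 a s
        exact h2 (has k h0 h1)
  -- the terms of `c` itself
  have hstart : ∀ c : IntegralChain G, ∃ L : List (AxialTerm X G),
      (∀ t ∈ L, IsAxis Γ t.elem t.len t.line) ∧
      (c.sum fun g n => n • chainClass g) - axialSum L ∈ chainSpan (ellipticSet X G) := by
    intro c
    induction c using Finsupp.induction_linear with
    | zero => exact ⟨[], by simp, by simp [axialSum]⟩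
    | add a b ha hb =>
      obtain ⟨L, hL, hLs⟩ := ha
      obtain ⟨L', hL', hLs'⟩ := hb
      refine ⟨L ++ L', fun t ht => (List.mem_append.1 ht).elim (hL t) (hL' t), ?_⟩
      rw [Finsupp.sum_add_index' (by simp) (by intros; exact add_smul _ _ _)]
      have e : axialSum (L ++ L') = axialSum L + axialSum L' := by simp [axialSum]
      rw [e, add_sub_add_comm]
      exact add_mem hLs hLs'
    | single g n =>
      rw [Finsupp.sum_single_index (by simp)]
      by_cases hg : ∃ y : X, g • y = y
      · refine ⟨[], by simp, ?_⟩
        simpa [axialSum] using zsmul_mem (chainClass_mem_chainSpan (s := ellipticSet X G) hg) n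
      · push Not at hg
        obtain ⟨τ, ℓ, hτ, hℓ, hgℓ⟩ := hT.exists_axis hg
        exact ⟨[⟨n, g, τ, ℓ⟩], by simpa using ⟨hτ, hℓ, hgℓ⟩, by simp [axialSum]⟩
  obtain ⟨L, hL, hLs⟩ := hstart c
  rw [← mkQ_toReal] at hLs
  exact key _ L rfl hL hLs

end Gap

/-! ### Reduced words -/

namespace EdgeWord

variable {E : Type*} {K : E → Type*} [∀ e, Group (K e)] {P : Type*} [Group P]
  (ι : ∀ e, Bool → K e →* P)

/-- The same edge with the opposite orientation. -/
def opp (d : E × Bool) : E × Bool := (d.1, !d.2)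

@[simp] theorem opp_opp (d : E × Bool) : opp (opp d) = d := by simp [opp]

/-- A syllable `x d` consists of an oriented edge `d` and a coset `x` in `P` of the subgroup
associated with the origin of `d`. A list of syllables `x₁ d₁, …, xₙ dₙ` stands for the coset
`g₁ d₁ ⋯ gₙ dₙ P` in the multiple HNN extension of `P`, where `gᵢ ∈ P` represents `xᵢ`. -/
abbrev Syllable : Type _ := Σ d : E × Bool, P ⧸ (ι d.1 d.2).range

variable {ι}

/-- The syllable with the trivial coset. -/
def triv (ι : ∀ e, Bool → K e →* P) (d : E × Bool) : Syllable ι := ⟨d, ((1 : P) : P ⧸ _)⟩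

open Classical in
/-- A representative of a coset, which is `1` for the trivial coset. -/
noncomputable def rep {d : E × Bool} (x : P ⧸ (ι d.1 d.2).range) : P :=
  if x = ((1 : P) : P ⧸ _) then 1 else x.out

theorem mk_rep {d : E × Bool} (x : P ⧸ (ι d.1 d.2).range) :
    ((rep x : P) : P ⧸ (ι d.1 d.2).range) = x := by
  rw [rep]
  split_ifs with h
  · exact h.symm
  · exact Quotient.out_eq' x

theorem rep_one {d : E × Bool} : rep ((1 : P) : P ⧸ (ι d.1 d.2).range) = 1 := if_pos rfl

theorem exists_cocycle (g : P) {d : E × Bool} (x : P ⧸ (ι d.1 d.2).range) :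
    ∃ k : K d.1, ι d.1 d.2 k = (rep (g • x))⁻¹ * (g * rep x) := by
  have : ((rep (g • x) : P) : P ⧸ (ι d.1 d.2).range) = ((g * rep x : P) : P ⧸ _) := by
    rw [mk_rep, ← smul_eq_mul, ← MulAction.Quotient.smul_coe, mk_rep]
  exact QuotientGroup.eq.1 this

/-- The element `k` of the edge group such that `g · rep x = rep (g x) · k`. -/
noncomputable def cocycle (g : P) {d : E × Bool} (x : P ⧸ (ι d.1 d.2).range) : K d.1 :=
  (exists_cocycle g x).choose

theorem map_cocycle (g : P) {d : E × Bool} (x : P ⧸ (ι d.1 d.2).range) :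
    ι d.1 d.2 (cocycle g x) = (rep (g • x))⁻¹ * (g * rep x) :=
  (exists_cocycle g x).choose_spec

section Cocycle

variable (hι : ∀ e b, Function.Injective (ι e b))
include hι

theorem cocycle_one {d : E × Bool} (x : P ⧸ (ι d.1 d.2).range) : cocycle 1 x = 1 := by
  apply hι d.1 d.2
  rw [map_cocycle]
  simp

theorem cocycle_mul (g h : P) {d : E × Bool} (x : P ⧸ (ι d.1 d.2).range) :
    cocycle (g * h) x = cocycle g (h • x) * cocycle h x := by
  apply hι d.1 d.2
  rw [map_mul, map_cocycle, map_cocycle, map_cocycle, mul_smul]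
  group

theorem cocycle_triv {d : E × Bool} (a : K d.1) :
    cocycle (ι d.1 d.2 a) ((1 : P) : P ⧸ (ι d.1 d.2).range) = a := by
  apply hι d.1 d.2
  have h : ι d.1 d.2 a • ((1 : P) : P ⧸ (ι d.1 d.2).range) = ((1 : P) : P ⧸ _) := by
    rw [MulAction.Quotient.smul_coe, smul_eq_mul, mul_one, QuotientGroup.eq]
    simp
  rw [map_cocycle, h, rep_one]
  simp

end Cocycle

/-- Left multiplication of a word by an element of `P`. -/
noncomputable def act : P → List (Syllable ι) → List (Syllable ι)
  | _, [] => []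
  | g, ⟨d, x⟩ :: w => ⟨d, g • x⟩ :: act (ι d.1 (!d.2) (cocycle g x)) w

open Classical in
/-- Left multiplication of a word by an oriented edge, with a cancellation if possible. -/
noncomputable def push (d : E × Bool) : List (Syllable ι) → List (Syllable ι)
  | [] => [triv ι d]
  | s :: w => if s = triv ι (opp d) then w else triv ι d :: s :: w

theorem act_nil (g : P) : act g ([] : List (Syllable ι)) = [] := rfl

theorem act_cons (g : P) (s : Syllable ι) (w : List (Syllable ι)) :
    act g (s :: w) = ⟨s.1, g • s.2⟩ :: act (ι s.1.1 (!s.1.2) (cocycle g s.2)) w := rfl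

theorem push_nil (d : E × Bool) : push d ([] : List (Syllable ι)) = [triv ι d] := rfl

theorem push_triv_opp (d : E × Bool) (w : List (Syllable ι)) :
    push d (triv ι (opp d) :: w) = w := if_pos rfl

theorem push_of_head?_ne {d : E × Bool} {w : List (Syllable ι)}
    (h : w.head? ≠ some (triv ι (opp d))) : push d w = triv ι d :: w := by
  cases w with
  | nil => rfl
  | cons s w => exact if_neg fun e => h (by rw [e]; rfl)

theorem length_act (g : P) (w : List (Syllable ι)) : (act g w).length = w.length := by
  induction w generalizing g with
  | nil => rfl
  | cons s w ih => rw [act_cons, List.length_cons, ih, List.length_cons]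

theorem smul_eq_triv_iff {d : E × Bool} (a : K d.1) (s : Syllable ι) :
    (⟨s.1, ι d.1 d.2 a • s.2⟩ : Syllable ι) = triv ι d ↔ s = triv ι d := by
  have h : ι d.1 d.2 a • ((1 : P) : P ⧸ (ι d.1 d.2).range) = ((1 : P) : P ⧸ _) := by
    rw [MulAction.Quotient.smul_coe, smul_eq_mul, mul_one, QuotientGroup.eq]
    simp
  obtain ⟨d', x⟩ := s
  constructor
  · intro e
    obtain rfl : d' = d := congrArg Sigma.fst e
    have e2 : ι d'.1 d'.2 a • x = ((1 : P) : P ⧸ _) := by simpa [triv] using e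
    rw [← h] at e2
    rw [MulAction.injective _ e2]
    rfl
  · intro e
    cases e
    exact congrArg (Sigma.mk d) h

theorem act_triv_cons (hι : ∀ e b, Function.Injective (ι e b)) (d : E × Bool) (a : K d.1)
    (w : List (Syllable ι)) :
    act (ι d.1 d.2 a) (triv ι d :: w) = triv ι d :: act (ι d.1 (!d.2) a) w := by
  rw [act_cons, (smul_eq_triv_iff a (triv ι d)).2 rfl]
  congr 2
  exact congrArg _ (cocycle_triv hι a)

theorem head?_act_ne {d : E × Bool} (a : K d.1) {w : List (Syllable ι)}
    (h : w.head? ≠ some (triv ι d)) : (act (ι d.1 d.2 a) w).head? ≠ some (triv ι d) := by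
  cases w with
  | nil => simp [act_nil]
  | cons s w =>
    rw [act_cons, List.head?_cons, Ne, Option.some.injEq, smul_eq_triv_iff]
    simpa using h

theorem act_one (hι : ∀ e b, Function.Injective (ι e b)) (w : List (Syllable ι)) :
    act 1 w = w := by
  induction w with
  | nil => rfl
  | cons s w ih => rw [act_cons, cocycle_one hι, map_one, ih, one_smul]

theorem act_mul (hι : ∀ e b, Function.Injective (ι e b)) (g h : P) (w : List (Syllable ι)) :
    act (g * h) w = act g (act h w) := by
  induction w generalizing g h with
  | nil => rfl
  | cons s w ih => rw [act_cons, cocycle_mul hι, map_mul, ih, mul_smul, act_cons, act_cons]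

/-- The relation `d a d⁻¹ = a` between the two images of an element `a` of an edge group. -/
theorem push_act (hι : ∀ e b, Function.Injective (ι e b)) (d : E × Bool) (a : K d.1)
    (w : List (Syllable ι)) :
    push d (act (ι d.1 (!d.2) a) w) = act (ι d.1 d.2 a) (push d w) := by
  by_cases h : w.head? = some (triv ι (opp d))
  · obtain ⟨w, rfl⟩ : ∃ w', w = triv ι (opp d) :: w' := by
      cases w with
      | nil => simp at h
      | cons s w => exact ⟨w, by rw [List.head?_cons, Option.some.injEq] at h; rw [h]⟩
    have h1 := act_triv_cons hι (opp d) a w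
    simp only [opp, Bool.not_not] at h1
    rw [push_triv_opp]
    exact (congrArg (push d) h1).trans (push_triv_opp d _)
  · have h1 := head?_act_ne (d := opp d) a h
    rw [push_of_head?_ne h, act_triv_cons hι]
    exact push_of_head?_ne h1

/-- A word is reduced if no two consecutive syllables cancel. -/
def IsReduced (w : List (Syllable ι)) : Prop :=
  w.IsChain fun s s' => s' ≠ triv ι (opp s.1)

theorem isReduced_cons {s : Syllable ι} {w : List (Syllable ι)} :
    IsReduced (s :: w) ↔ w.head? ≠ some (triv ι (opp s.1)) ∧ IsReduced w := by
  cases w with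
  | nil => simp [IsReduced]
  | cons s' w => simp [IsReduced, List.isChain_cons_cons]

theorem IsReduced.act {w : List (Syllable ι)} (h : IsReduced w) (g : P) :
    IsReduced (act g w) := by
  induction w generalizing g with
  | nil => exact h
  | cons s w ih =>
    rw [isReduced_cons] at h
    rw [act_cons, isReduced_cons]
    exact ⟨head?_act_ne (d := opp s.1) _ h.1, ih h.2 _⟩

theorem IsReduced.push {w : List (Syllable ι)} (h : IsReduced w) (d : E × Bool) :
    IsReduced (push d w) := by
  by_cases hw : w.head? = some (triv ι (opp d))
  · cases w with
    | nil => simp at hw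
    | cons s w =>
      rw [List.head?_cons, Option.some.injEq] at hw
      rw [hw, push_triv_opp]
      exact (isReduced_cons.1 h).2
  · rw [push_of_head?_ne hw, isReduced_cons]
    exact ⟨hw, h⟩

theorem IsReduced.push_opp_push {w : List (Syllable ι)} (h : IsReduced w) (d : E × Bool) :
    EdgeWord.push (opp d) (EdgeWord.push d w) = w := by
  by_cases hw : w.head? = some (triv ι (opp d))
  · cases w with
    | nil => simp at hw
    | cons s w =>
      rw [List.head?_cons, Option.some.injEq] at hw
      subst hw
      rw [push_triv_opp]
      exact push_of_head?_ne (isReduced_cons.1 h).1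
  · rw [push_of_head?_ne hw]
    have := push_triv_opp (ι := ι) (opp d) w
    rwa [opp_opp] at this

/-- Two words are adjacent if one of them is obtained from the other one by deleting the last
syllable. -/
def WordAdj (w w' : List (Syllable ι)) : Prop := (∃ s, w' = w ++ [s]) ∨ ∃ s, w = w' ++ [s]

theorem WordAdj.symm {w w' : List (Syllable ι)} (h : WordAdj w w') : WordAdj w' w := Or.symm h

theorem exists_act_concat (g : P) (w : List (Syllable ι)) (s : Syllable ι) :
    ∃ s', act g (w ++ [s]) = act g w ++ [s'] := by
  induction w generalizing g with
  | nil => exact ⟨_, rfl⟩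
  | cons s' w ih =>
    obtain ⟨s'', hs⟩ := ih (ι s'.1.1 (!s'.1.2) (cocycle g s'.2))
    exact ⟨s'', by rw [List.cons_append, act_cons, hs, act_cons, List.cons_append]⟩

theorem WordAdj.act {w w' : List (Syllable ι)} (h : WordAdj w w') (g : P) :
    WordAdj (act g w) (act g w') := by
  rcases h with ⟨s, rfl⟩ | ⟨s, rfl⟩
  exacts [Or.inl (exists_act_concat g w s), Or.inr (exists_act_concat g w' s)]

theorem wordAdj_push_concat (d : E × Bool) (w : List (Syllable ι)) (s : Syllable ι) :
    WordAdj (push d w) (push d (w ++ [s])) := by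
  cases w with
  | nil =>
    by_cases hs : s = triv ι (opp d)
    · subst hs
      right
      exact ⟨triv ι d, by rw [List.nil_append, push_triv_opp, push_nil, List.nil_append]⟩
    · left
      exact ⟨s, by rw [List.nil_append, push_of_head?_ne (by simpa using hs), push_nil]; rfl⟩
  | cons s' w =>
    left
    refine ⟨s, ?_⟩
    by_cases hs : s' = triv ι (opp d)
    · subst hs
      rw [List.cons_append, push_triv_opp, push_triv_opp]
    · rw [List.cons_append, push_of_head?_ne (by simpa using hs),
        push_of_head?_ne (by simpa using hs)]
      rfl

theorem WordAdj.push {w w' : List (Syllable ι)} (h : WordAdj w w') (d : E × Bool) :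
    WordAdj (push d w) (push d w') := by
  rcases h with ⟨s, rfl⟩ | ⟨s, rfl⟩
  exacts [wordAdj_push_concat d w s, (wordAdj_push_concat d w' s).symm]

variable (ι) in
/-- The type of reduced words. -/
abbrev ReducedWord : Type _ := {w : List (Syllable ι) // IsReduced w}

/-- The empty word. -/
def root : ReducedWord ι := ⟨[], List.isChain_nil⟩

variable (ι) in
/-- The graph of reduced words, in which a word is joined with the words obtained by appending
a syllable. -/
def wordGraph : SimpleGraph (ReducedWord ι) where
  Adj w w' := WordAdj w.1 w'.1
  symm := ⟨fun _ _ h => WordAdj.symm h⟩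
  loopless := ⟨fun w h => by
    rcases h with ⟨s, hs⟩ | ⟨s, hs⟩ <;> simpa using congrArg List.length hs⟩

theorem wordGraph_adj {w w' : ReducedWord ι} : (wordGraph ι).Adj w w' ↔ WordAdj w.1 w'.1 :=
  Iff.rfl

/-- The longest word on a cycle would have only one neighbour on the cycle. -/
theorem wordGraph_isAcyclic : (wordGraph ι).IsAcyclic := by
  classical
  intro w p hp
  obtain ⟨m, hm, hmax⟩ := Set.exists_max_image {y | y ∈ p.support}
    (fun y : ReducedWord ι => y.1.length) p.support.finite_toSet ⟨w, p.start_mem_support⟩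
  have hq := SimpleGraph.Walk.IsCycle.rotate hm hp
  have hsupp : ∀ y ∈ (p.rotate m hm).support, y.1.length ≤ m.1.length := fun y hy =>
    hmax y ((SimpleGraph.Walk.mem_support_rotate_iff p m hm).1 hy)
  generalize p.rotate m hm = q at hq hsupp
  have key : ∀ y : ReducedWord ι, (wordGraph ι).Adj m y → y ∈ q.support →
      y.1 = m.1.dropLast := by
    rintro y (⟨s, hs⟩ | ⟨s, hs⟩) hy
    · have h1 := hsupp y hy
      rw [hs, List.length_append] at h1
      simp at h1
    · rw [hs, List.dropLast_concat]
  have h1 := key q.snd (q.adj_snd hq.not_nil) (q.getVert_mem_support 1)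
  have h2 := key q.penultimate (q.adj_penultimate hq.not_nil).symm (q.getVert_mem_support _)
  exact hq.snd_ne_penultimate (Subtype.ext (h1.trans h2.symm))

/-- The action of `P` on reduced words. -/
noncomputable def actHom (hι : ∀ e b, Function.Injective (ι e b)) :
    P →* Equiv.Perm (ReducedWord ι) where
  toFun g :=
    { toFun := fun w => ⟨act g w.1, w.2.act g⟩
      invFun := fun w => ⟨act g⁻¹ w.1, w.2.act g⁻¹⟩
      left_inv := fun w => Subtype.ext (by
        change act g⁻¹ (act g w.1) = w.1
        rw [← act_mul hι, inv_mul_cancel, act_one hι])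
      right_inv := fun w => Subtype.ext (by
        change act g (act g⁻¹ w.1) = w.1
        rw [← act_mul hι, mul_inv_cancel, act_one hι]) }
  map_one' := Equiv.ext fun w => Subtype.ext (act_one hι w.1)
  map_mul' g h := Equiv.ext fun w => Subtype.ext (act_mul hι g h w.1)

/-- The action of an edge on reduced words. -/
noncomputable def edgePerm (e : E) : Equiv.Perm (ReducedWord ι) where
  toFun w := ⟨push (e, true) w.1, w.2.push _⟩
  invFun w := ⟨push (e, false) w.1, w.2.push _⟩
  left_inv w := Subtype.ext (w.2.push_opp_push (e, true))
  right_inv w := Subtype.ext (w.2.push_opp_push (e, false))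

end EdgeWord

/-! ### The Bass–Serre tree -/

namespace GraphOfGroups

open EdgeWord

variable (𝒢 : GraphOfGroups.{u, v, w, x})

/-- The origin of an oriented edge. -/
def origin : 𝒢.E × Bool → 𝒢.V
  | (e, true) => 𝒢.src e
  | (e, false) => 𝒢.tgt e

/-- The embedding of an edge group into the group of the origin of the oriented edge. -/
def toOrigin : ∀ d : 𝒢.E × Bool, 𝒢.edgeGroup d.1 →* 𝒢.vertexGroup (𝒢.origin d)
  | (e, true) => 𝒢.toSrc e
  | (e, false) => 𝒢.toTgt e

theorem toOrigin_injective : ∀ d, Function.Injective (𝒢.toOrigin d)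
  | (e, true) => 𝒢.toSrc_injective e
  | (e, false) => 𝒢.toTgt_injective e

/-- The element of the path group given by an oriented edge. -/
def letter : 𝒢.E × Bool → 𝒢.PathGroup
  | (e, true) => 𝒢.ofEdge e
  | (e, false) => (𝒢.ofEdge e)⁻¹

theorem letter_opp : ∀ d, 𝒢.letter (opp d) = (𝒢.letter d)⁻¹
  | (_, true) => rfl
  | (_, false) => (inv_inv _).symm

theorem isPath_letter : ∀ d, 𝒢.IsPath (𝒢.origin d) (𝒢.origin (opp d)) (𝒢.letter d)
  | (e, true) => .edge e
  | (e, false) => .edgeInv e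

theorem ofEdge_mul_ofVertex (e : 𝒢.E) (a : 𝒢.edgeGroup e) :
    𝒢.ofEdge e * 𝒢.ofVertex _ (𝒢.toTgt e a) = 𝒢.ofVertex _ (𝒢.toSrc e a) * 𝒢.ofEdge e := by
  rw [← mul_inv_eq_iff_eq_mul, ← mul_inv_eq_one]
  exact (QuotientGroup.eq_one_iff _).2 (Subgroup.subset_normalClosure ⟨e, a, rfl⟩)

theorem letter_mul_ofVertex : ∀ (d : 𝒢.E × Bool) (a : 𝒢.edgeGroup d.1),
    𝒢.letter d * 𝒢.ofVertex _ (𝒢.toOrigin (opp d) a) =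
      𝒢.ofVertex _ (𝒢.toOrigin d a) * 𝒢.letter d
  | (e, true), a => 𝒢.ofEdge_mul_ofVertex e a
  | (e, false), a => by
    have := 𝒢.ofEdge_mul_ofVertex e a
    change (𝒢.ofEdge e)⁻¹ * 𝒢.ofVertex _ (𝒢.toSrc e a) =
      𝒢.ofVertex _ (𝒢.toTgt e a) * (𝒢.ofEdge e)⁻¹
    rw [inv_mul_eq_iff_eq_mul, ← mul_assoc, this, mul_inv_cancel_right]

/-- The product of all the vertex groups. -/
abbrev VertexProduct : Type _ := ∀ a, 𝒢.vertexGroup a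

open Classical in
/-- The embedding of a vertex group into the product of the vertex groups. -/
noncomputable def single (a : 𝒢.V) : 𝒢.vertexGroup a →* 𝒢.VertexProduct :=
  MonoidHom.mulSingle 𝒢.vertexGroup a

theorem single_injective (a : 𝒢.V) : Function.Injective (𝒢.single a) := by
  classical
  exact Pi.mulSingle_injective a

/-- The embeddings of the edge groups into the product of the vertex groups. -/
noncomputable def edgeMap (e : 𝒢.E) (b : Bool) : 𝒢.edgeGroup e →* 𝒢.VertexProduct :=
  (𝒢.single (𝒢.origin (e, b))).comp (𝒢.toOrigin (e, b))

theorem edgeMap_injective (e : 𝒢.E) (b : Bool) : Function.Injective (𝒢.edgeMap e b) :=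
  (𝒢.single_injective _).comp (𝒢.toOrigin_injective _)

/-- The action of the word group on reduced words. -/
noncomputable def wordHom : 𝒢.WordGroup →* Equiv.Perm (ReducedWord 𝒢.edgeMap) :=
  Monoid.Coprod.lift
    (Monoid.CoprodI.lift fun a => (actHom 𝒢.edgeMap_injective).comp (𝒢.single a))
    (FreeGroup.lift edgePerm)

theorem relators_subset_ker : 𝒢.relators ⊆ 𝒢.wordHom.ker := by
  rintro _ ⟨e, a, rfl⟩
  rw [SetLike.mem_coe, MonoidHom.mem_ker, map_mul, map_mul, map_mul, map_inv, map_inv,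
    mul_inv_eq_one, mul_inv_eq_iff_eq_mul]
  simp only [wordHom, Monoid.Coprod.lift_apply_inl, Monoid.Coprod.lift_apply_inr,
    FreeGroup.lift_apply_of, Monoid.CoprodI.lift_of]
  exact Equiv.ext fun w => Subtype.ext (push_act 𝒢.edgeMap_injective (e, true) a w.1)

/-- The action of the path group on reduced words. -/
noncomputable def pathHom : 𝒢.PathGroup →* Equiv.Perm (ReducedWord 𝒢.edgeMap) :=
  QuotientGroup.lift _ 𝒢.wordHom (Subgroup.normalClosure_le_normal 𝒢.relators_subset_ker)

theorem pathHom_ofVertex (a : 𝒢.V) (g : 𝒢.vertexGroup a) (w : ReducedWord 𝒢.edgeMap) :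
    (𝒢.pathHom (𝒢.ofVertex a g) w).1 = act (𝒢.single a g) w.1 := by
  have : 𝒢.pathHom (𝒢.ofVertex a g) = actHom 𝒢.edgeMap_injective (𝒢.single a g) := by
    refine (QuotientGroup.lift_mk' _ _ _).trans ?_
    simp [wordHom]
  rw [this]
  rfl

theorem pathHom_ofEdge (e : 𝒢.E) : 𝒢.pathHom (𝒢.ofEdge e) = edgePerm e := by
  refine (QuotientGroup.lift_mk' _ _ _).trans ?_
  simp [wordHom]

theorem pathHom_letter : ∀ (d : 𝒢.E × Bool) (w : ReducedWord 𝒢.edgeMap),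
    (𝒢.pathHom (𝒢.letter d) w).1 = push d w.1
  | (e, true), w => by rw [letter, pathHom_ofEdge]; rfl
  | (e, false), w => by rw [letter, map_inv, pathHom_ofEdge]; rfl

theorem pathHom_ofVertex_root (a : 𝒢.V) (g : 𝒢.vertexGroup a) :
    𝒢.pathHom (𝒢.ofVertex a g) root = root :=
  Subtype.ext (𝒢.pathHom_ofVertex a g root)

/-- `𝒢.IsReducedPath a b p n`: the element `p` of the path group is represented by a reduced word
along a path of length `n` from `a` to `b`. -/
inductive IsReducedPath : 𝒢.V → 𝒢.V → 𝒢.PathGroup → ℕ → Prop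
  | vertex (a : 𝒢.V) (g : 𝒢.vertexGroup a) : IsReducedPath a a (𝒢.ofVertex a g) 0
  | cons (d : 𝒢.E × Bool) (g : 𝒢.vertexGroup (𝒢.origin d)) {c : 𝒢.V} {q : 𝒢.PathGroup} {n : ℕ} :
      IsReducedPath (𝒢.origin (opp d)) c q n →
      (𝒢.pathHom q root).1.head? ≠ some (triv 𝒢.edgeMap (opp d)) →
      IsReducedPath (𝒢.origin d) c (𝒢.ofVertex _ g * 𝒢.letter d * q) (n + 1)

variable {𝒢}

theorem pathHom_cons (d : 𝒢.E × Bool) (g : 𝒢.vertexGroup (𝒢.origin d)) {q : 𝒢.PathGroup}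
    (hq : (𝒢.pathHom q root).1.head? ≠ some (triv 𝒢.edgeMap (opp d))) :
    (𝒢.pathHom (𝒢.ofVertex _ g * 𝒢.letter d * q) root).1 =
      act (𝒢.single _ g) (triv 𝒢.edgeMap d :: (𝒢.pathHom q root).1) := by
  rw [map_mul, map_mul, Equiv.Perm.mul_apply, Equiv.Perm.mul_apply, pathHom_ofVertex,
    pathHom_letter, push_of_head?_ne hq]

theorem IsReducedPath.length_eq {a b : 𝒢.V} {p : 𝒢.PathGroup} {n : ℕ}
    (h : 𝒢.IsReducedPath a b p n) : (𝒢.pathHom p root).1.length = n := by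
  induction h with
  | vertex a g => rw [pathHom_ofVertex_root]; rfl
  | cons d g _ hq ih => rw [pathHom_cons d g hq, length_act, List.length_cons, ih]

theorem IsReducedPath.ofVertex_mul {a b : 𝒢.V} {p : 𝒢.PathGroup} {n : ℕ}
    (h : 𝒢.IsReducedPath a b p n) (g : 𝒢.vertexGroup a) :
    𝒢.IsReducedPath a b (𝒢.ofVertex a g * p) n := by
  cases h with
  | vertex _ g' =>
    rw [← map_mul]
    exact .vertex _ _
  | cons d g' hq hq' =>
    rw [← mul_assoc, ← mul_assoc, ← map_mul]
    exact .cons d _ hq hq'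

theorem single_mem_range_iff {d : 𝒢.E × Bool} {g : 𝒢.vertexGroup (𝒢.origin d)} :
    𝒢.single _ g ∈ (𝒢.edgeMap d.1 d.2).range ↔ ∃ a, 𝒢.toOrigin d a = g := by
  constructor
  · rintro ⟨a, ha⟩
    exact ⟨a, 𝒢.single_injective _ ha⟩
  · rintro ⟨a, rfl⟩
    exact ⟨a, rfl⟩

theorem single_smul_eq_triv {d d' : 𝒢.E × Bool} {g : 𝒢.vertexGroup (𝒢.origin d)}
    (h : (⟨d, 𝒢.single _ g • (triv 𝒢.edgeMap d).2⟩ : Syllable 𝒢.edgeMap) = triv 𝒢.edgeMap d') :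
    d = d' ∧ ∃ a, 𝒢.toOrigin d a = g := by
  obtain rfl : d = d' := congrArg Sigma.fst h
  refine ⟨rfl, single_mem_range_iff.1 ?_⟩
  have h1 : 𝒢.single _ g • (triv 𝒢.edgeMap d).2 = (triv 𝒢.edgeMap d).2 :=
    eq_of_heq (Sigma.ext_iff.1 h).2
  have h2 : ((𝒢.single _ g * 1 : 𝒢.VertexProduct) :
      𝒢.VertexProduct ⧸ (𝒢.edgeMap d.1 d.2).range) = ((1 : 𝒢.VertexProduct) : _ ⧸ _) := h1
  rw [mul_one] at h2
  simpa using QuotientGroup.eq.1 h2.symm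

theorem IsReducedPath.exists_of_head? {b c : 𝒢.V} {q : 𝒢.PathGroup} {n : ℕ}
    (h : 𝒢.IsReducedPath b c q n) {d : 𝒢.E × Bool}
    (hd : (𝒢.pathHom q root).1.head? = some (triv 𝒢.edgeMap (opp d))) :
    ∃ (m : ℕ) (q' : 𝒢.PathGroup) (a : 𝒢.edgeGroup d.1), 𝒢.IsReducedPath (𝒢.origin d) c q' m ∧
      q = 𝒢.ofVertex _ (𝒢.toOrigin (opp d) a) * 𝒢.letter (opp d) * q' := by
  cases h with
  | vertex a g =>
    rw [pathHom_ofVertex_root] at hd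
    simp [root] at hd
  | cons d' g' hq' hq'' =>
    rw [pathHom_cons d' g' hq'', act_cons, List.head?_cons, Option.some.injEq] at hd
    obtain ⟨rfl, a, rfl⟩ := single_smul_eq_triv hd
    rw [opp_opp] at hq'
    exact ⟨_, _, a, hq', rfl⟩

theorem IsReducedPath.exists_letter_mul {c : 𝒢.V} {q : 𝒢.PathGroup} {n : ℕ} (d : 𝒢.E × Bool)
    (h : 𝒢.IsReducedPath (𝒢.origin (opp d)) c q n) :
    ∃ m, 𝒢.IsReducedPath (𝒢.origin d) c (𝒢.letter d * q) m := by
  by_cases hd : (𝒢.pathHom q root).1.head? = some (triv 𝒢.edgeMap (opp d))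
  · obtain ⟨m, q', a, hq', rfl⟩ := h.exists_of_head? hd
    refine ⟨m, ?_⟩
    rw [← mul_assoc, ← mul_assoc, letter_mul_ofVertex, letter_opp, mul_inv_cancel_right]
    exact hq'.ofVertex_mul _
  · have := IsReducedPath.cons d 1 h hd
    rw [map_one, one_mul] at this
    exact ⟨_, this⟩

theorem IsPath.exists_mul_isReducedPath {a b : 𝒢.V} {p : 𝒢.PathGroup} (hp : 𝒢.IsPath a b p)
    {c : 𝒢.V} {q : 𝒢.PathGroup} {n : ℕ} (hq : 𝒢.IsReducedPath b c q n) :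
    ∃ m, 𝒢.IsReducedPath a c (p * q) m := by
  induction hp generalizing q n with
  | vertex a g => exact ⟨n, hq.ofVertex_mul g⟩
  | edge e => exact IsReducedPath.exists_letter_mul (e, true) hq
  | edgeInv e => exact IsReducedPath.exists_letter_mul (e, false) hq
  | comp _ _ ih₁ ih₂ =>
    obtain ⟨m, hm⟩ := ih₂ hq
    rw [mul_assoc]
    exact ih₁ hm

theorem IsPath.isReducedPath {a b : 𝒢.V} {p : 𝒢.PathGroup} (hp : 𝒢.IsPath a b p) :
    𝒢.IsReducedPath a b p (𝒢.pathHom p root).1.length := by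
  obtain ⟨m, hm⟩ := hp.exists_mul_isReducedPath (.vertex b 1)
  rw [map_one, mul_one] at hm
  rwa [hm.length_eq]

/-- A path that fixes the empty word is an element of a vertex group. -/
theorem IsPath.exists_eq_ofVertex {a b : 𝒢.V} {p : 𝒢.PathGroup} (hp : 𝒢.IsPath a b p)
    (h : 𝒢.pathHom p root = root) : ∃ g, p = 𝒢.ofVertex a g := by
  have h1 := hp.isReducedPath
  rw [h] at h1
  generalize hn : (root : ReducedWord 𝒢.edgeMap).1.length = n at h1
  cases h1 with
  | vertex _ g => exact ⟨g, rfl⟩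
  | cons => simp [root] at hn

/-- A path that moves the empty word to an adjacent word is of the form `g d g'` for an oriented
edge `d`. -/
theorem IsPath.exists_eq_mul_letter_mul {a b : 𝒢.V} {p : 𝒢.PathGroup} (hp : 𝒢.IsPath a b p)
    (h : (wordGraph 𝒢.edgeMap).Adj root (𝒢.pathHom p root)) :
    ∃ (d : 𝒢.E × Bool) (g : 𝒢.vertexGroup (𝒢.origin d)) (g' : 𝒢.vertexGroup (𝒢.origin (opp d))),
      𝒢.origin d = a ∧ p = 𝒢.ofVertex _ g * 𝒢.letter d * 𝒢.ofVertex _ g' := by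
  have h1 := hp.isReducedPath
  have hlen : (𝒢.pathHom p root).1.length = 1 := by
    rcases h with ⟨s, hs⟩ | ⟨s, hs⟩
    · rw [hs]
      rfl
    · exact absurd (congrArg List.length hs) (by simp [root])
  generalize hn : (𝒢.pathHom p root).1.length = n at h1
  cases h1 with
  | vertex _ g => omega
  | cons d g hq hq' =>
    rename_i q n
    generalize hc : 𝒢.origin (opp d) = c at hq
    obtain rfl : n = 0 := by omega
    cases hq with
    | vertex _ g' =>
      subst hc
      exact ⟨d, g, g', rfl, rfl⟩

variable (𝒢)

/-- The vertices of the Bass–Serre tree of `𝒢` with respect to the base vertex `a`: the reduced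
words given by paths from `a`. -/
def treeVertices (a : 𝒢.V) : Set (ReducedWord 𝒢.edgeMap) :=
  {w | ∃ b p, 𝒢.IsPath a b p ∧ 𝒢.pathHom p root = w}

/-- The Bass–Serre tree. -/
noncomputable abbrev tree (a : 𝒢.V) : SimpleGraph (𝒢.treeVertices a) :=
  (wordGraph 𝒢.edgeMap).induce (𝒢.treeVertices a)

variable {𝒢}

/-- The vertex of the Bass–Serre tree given by a path. -/
noncomputable def treeVertex {a b : 𝒢.V} {p : 𝒢.PathGroup} (hp : 𝒢.IsPath a b p) :
    𝒢.treeVertices a :=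
  ⟨𝒢.pathHom p root, b, p, hp, rfl⟩

noncomputable instance (a : 𝒢.V) :
    MulAction (𝒢.fundamentalGroup a) (𝒢.treeVertices a) where
  smul g w := ⟨𝒢.pathHom g.1 w.1, by
    obtain ⟨b, p, hp, hw⟩ := w.2
    exact ⟨b, g.1 * p, g.2.comp hp, by rw [map_mul, Equiv.Perm.mul_apply, hw]⟩⟩
  one_smul w := Subtype.ext (by
    change 𝒢.pathHom 1 w.1 = w.1
    rw [map_one]
    rfl)
  mul_smul g h w := Subtype.ext (by
    change 𝒢.pathHom (g.1 * h.1) w.1 = 𝒢.pathHom g.1 (𝒢.pathHom h.1 w.1)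
    rw [map_mul]
    rfl)

theorem IsPath.adj_pathHom {a b : 𝒢.V} {p : 𝒢.PathGroup} (hp : 𝒢.IsPath a b p)
    {w w' : ReducedWord 𝒢.edgeMap} (h : (wordGraph 𝒢.edgeMap).Adj w w') :
    (wordGraph 𝒢.edgeMap).Adj (𝒢.pathHom p w) (𝒢.pathHom p w') := by
  induction hp generalizing w w' with
  | vertex a g =>
    rw [wordGraph_adj, pathHom_ofVertex, pathHom_ofVertex]
    exact h.act _
  | edge e =>
    have := WordAdj.push h (e, true)
    rwa [← pathHom_letter, ← pathHom_letter] at this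
  | edgeInv e =>
    have := WordAdj.push h (e, false)
    rwa [← pathHom_letter, ← pathHom_letter] at this
  | comp _ _ ih₁ ih₂ =>
    rw [map_mul]
    exact ih₁ (ih₂ h)

theorem adj_root_letter (d : 𝒢.E × Bool) :
    (wordGraph 𝒢.edgeMap).Adj root (𝒢.pathHom (𝒢.letter d) root) := by
  rw [wordGraph_adj, pathHom_letter]
  exact Or.inl ⟨triv 𝒢.edgeMap d, rfl⟩

theorem IsPath.reachable {a b c : 𝒢.V} {p q : 𝒢.PathGroup} (hp : 𝒢.IsPath b c p)
    (hq : 𝒢.IsPath a b q) :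
    (𝒢.tree a).Reachable (treeVertex hq) (treeVertex (hq.comp hp)) := by
  have hstep : ∀ (d : 𝒢.E × Bool) (q : 𝒢.PathGroup) (hq : 𝒢.IsPath a (𝒢.origin d) q),
      (𝒢.tree a).Reachable (treeVertex hq) (treeVertex (hq.comp (𝒢.isPath_letter d))) := by
    intro d q hq
    refine SimpleGraph.Adj.reachable ?_
    change (wordGraph 𝒢.edgeMap).Adj (𝒢.pathHom q root) (𝒢.pathHom (q * 𝒢.letter d) root)
    rw [map_mul]
    exact hq.adj_pathHom (adj_root_letter d)
  induction hp generalizing q with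
  | vertex b g =>
    have : treeVertex (hq.comp (.vertex b g)) = treeVertex hq := Subtype.ext (by
      change 𝒢.pathHom (q * 𝒢.ofVertex b g) root = 𝒢.pathHom q root
      rw [map_mul, Equiv.Perm.mul_apply, pathHom_ofVertex_root])
    rw [this]
  | edge e => exact hstep (e, true) q hq
  | edgeInv e => exact hstep (e, false) q hq
  | comp h₁ h₂ ih₁ ih₂ =>
    have h := (ih₁ hq).trans (ih₂ (hq.comp h₁))
    convert h using 2
    rw [mul_assoc]

theorem tree_isTree (a : 𝒢.V) : (𝒢.tree a).IsTree := by
  refine ⟨(SimpleGraph.connected_iff_exists_forall_reachable _).2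
    ⟨treeVertex (.vertex a 1), ?_⟩, wordGraph_isAcyclic.induce _⟩
  rintro ⟨_, b, p, hp, rfl⟩
  have h := hp.reachable (.vertex a 1)
  have e : treeVertex ((IsPath.vertex a 1).comp hp) = treeVertex hp := Subtype.ext (by
    change 𝒢.pathHom (𝒢.ofVertex a 1 * p) root = 𝒢.pathHom p root
    rw [map_one, one_mul])
  rwa [e] at h

/-- An edge of the Bass–Serre tree comes from an edge of the graph, up to its orientation. -/
theorem exists_edge_of_adj {a : 𝒢.V} {y z : 𝒢.treeVertices a} (h : (𝒢.tree a).Adj y z) :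
    ∃ (e : 𝒢.E) (q : 𝒢.PathGroup) (hq : 𝒢.IsPath a (𝒢.src e) q),
      (y = treeVertex hq ∧ z = treeVertex (hq.comp (.edge e))) ∨
      (z = treeVertex hq ∧ y = treeVertex (hq.comp (.edge e))) := by
  obtain ⟨_, b, p, hp, rfl⟩ := y
  obtain ⟨_, c, r, hr, rfl⟩ := z
  have h1 : (wordGraph 𝒢.edgeMap).Adj (𝒢.pathHom p root) (𝒢.pathHom r root) := h
  have h2 := hp.inv.adj_pathHom h1
  rw [← Equiv.Perm.mul_apply, ← Equiv.Perm.mul_apply, ← map_mul, ← map_mul, inv_mul_cancel,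
    map_one, Equiv.Perm.one_apply] at h2
  obtain ⟨⟨e, b'⟩, g, g', rfl, hpr⟩ := (hp.inv.comp hr).exists_eq_mul_letter_mul h2
  have hr' : r = p * 𝒢.ofVertex _ g * 𝒢.letter (e, b') * 𝒢.ofVertex _ g' := by
    rw [mul_assoc p, mul_assoc p, ← hpr, mul_inv_cancel_left]
  have hpg : 𝒢.pathHom p root = 𝒢.pathHom (p * 𝒢.ofVertex _ g) root := by
    rw [map_mul, Equiv.Perm.mul_apply, pathHom_ofVertex_root]
  have hrg : 𝒢.pathHom r root = 𝒢.pathHom (p * 𝒢.ofVertex _ g * 𝒢.letter (e, b')) root := by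
    rw [hr', map_mul _ _ (𝒢.ofVertex _ g'), Equiv.Perm.mul_apply, pathHom_ofVertex_root]
  cases b' with
  | true => exact ⟨e, _, hp.comp (.vertex _ g), Or.inl ⟨Subtype.ext hpg, Subtype.ext hrg⟩⟩
  | false =>
    refine ⟨e, _, (hp.comp (.vertex _ g)).comp (.edgeInv e),
      Or.inr ⟨Subtype.ext hrg, Subtype.ext ?_⟩⟩
    change _ = 𝒢.pathHom (p * 𝒢.ofVertex _ g * (𝒢.ofEdge e)⁻¹ * 𝒢.ofEdge e) root
    rw [inv_mul_cancel_right]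
    exact hpg

/-- The stabilizer of a vertex of the Bass–Serre tree is a conjugate of a vertex group. -/
theorem exists_of_smul_treeVertex_eq {a b : 𝒢.V} {q : 𝒢.PathGroup} (hq : 𝒢.IsPath a b q)
    {h : 𝒢.fundamentalGroup a} (hh : h • treeVertex hq = treeVertex hq) :
    ∃ g, h.1 = q * 𝒢.ofVertex b g * q⁻¹ := by
  have h1 : 𝒢.pathHom h.1 (𝒢.pathHom q root) = 𝒢.pathHom q root := congrArg Subtype.val hh
  obtain ⟨g, hg⟩ := ((hq.inv.comp h.2).comp hq).exists_eq_ofVertex (by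
    rw [map_mul, map_mul, Equiv.Perm.mul_apply, Equiv.Perm.mul_apply, h1, map_inv,
      ← Equiv.Perm.mul_apply, inv_mul_cancel, Equiv.Perm.one_apply])
  exact ⟨g, by rw [← hg]; group⟩

theorem smul_treeVertex_eq {a b : 𝒢.V} {q : 𝒢.PathGroup} (hq : 𝒢.IsPath a b q)
    (h : 𝒢.fundamentalGroup a) {g : 𝒢.vertexGroup b} (hg : h.1 = q * 𝒢.ofVertex b g * q⁻¹) :
    h • treeVertex hq = treeVertex hq := by
  refine Subtype.ext ?_
  change 𝒢.pathHom h.1 (𝒢.pathHom q root) = 𝒢.pathHom q root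
  rw [hg, ← Equiv.Perm.mul_apply, ← map_mul, inv_mul_cancel_right, map_mul, Equiv.Perm.mul_apply,
    pathHom_ofVertex_root]

/-- The stabilizer of an edge of the Bass–Serre tree is a conjugate of an edge group. -/
theorem stabilizer_edge {a : 𝒢.V} (e : 𝒢.E) {q : 𝒢.PathGroup} (hq : 𝒢.IsPath a (𝒢.src e) q) :
    MulAction.stabilizer (𝒢.fundamentalGroup a) (treeVertex hq) ⊓
        MulAction.stabilizer (𝒢.fundamentalGroup a) (treeVertex (hq.comp (.edge e))) =
      (𝒢.edgeEmbedding e (q * 𝒢.ofEdge e) (hq.comp (.edge e))).range := by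
  have hconj : ∀ k : 𝒢.edgeGroup e,
      q * 𝒢.ofEdge e * 𝒢.ofVertex _ (𝒢.toTgt e k) * (q * 𝒢.ofEdge e)⁻¹ =
        q * 𝒢.ofVertex _ (𝒢.toSrc e k) * q⁻¹ := fun k => by
    rw [mul_assoc q, ofEdge_mul_ofVertex]
    group
  ext h
  constructor
  · rintro ⟨h1, h2⟩
    obtain ⟨g, hg⟩ := exists_of_smul_treeVertex_eq hq h1
    have h3 : 𝒢.pathHom h.1 (𝒢.pathHom (q * 𝒢.ofEdge e) root) =
        𝒢.pathHom (q * 𝒢.ofEdge e) root := congrArg Subtype.val h2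
    rw [hg, ← Equiv.Perm.mul_apply, ← map_mul, ← mul_assoc, inv_mul_cancel_right, mul_assoc,
      map_mul _ q, map_mul _ q, Equiv.Perm.mul_apply, Equiv.Perm.mul_apply] at h3
    have h4 := congrArg Subtype.val ((𝒢.pathHom q).injective h3)
    have e1 : (𝒢.pathHom (𝒢.ofEdge e) root).1 = [triv 𝒢.edgeMap (e, true)] :=
      (𝒢.pathHom_letter (e, true) root).trans (push_nil _)
    rw [map_mul, Equiv.Perm.mul_apply, pathHom_ofVertex, e1, act_cons, List.cons.injEq] at h4
    obtain ⟨-, k, hk⟩ := single_smul_eq_triv (d := (e, true)) (g := g) h4.1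
    refine ⟨k, Subtype.ext ?_⟩
    refine (hconj k).trans ?_
    rw [hg, ← hk]
    rfl
  · rintro ⟨k, rfl⟩
    exact ⟨smul_treeVertex_eq hq _ (hconj k), smul_treeVertex_eq (hq.comp (.edge e)) _ rfl⟩

theorem isTreeAction (a : 𝒢.V) : IsTreeAction (𝒢.fundamentalGroup a) (𝒢.tree a) where
  isTree := tree_isTree a
  adj_smul g _ _ h := g.2.adj_pathHom h
  no_inversion h y z hyz h1 h2 := by
    -- an inversion of the edge `(q, q e)` has the form `q e g q⁻¹`, so `e g e` fixes the empty word
    obtain ⟨e, q, hq, hyz⟩ := exists_edge_of_adj hyz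
    have key : h • treeVertex hq = treeVertex (hq.comp (.edge e)) ∧
        h • treeVertex (hq.comp (.edge e)) = treeVertex hq := by
      rcases hyz with ⟨rfl, rfl⟩ | ⟨rfl, rfl⟩
      exacts [⟨h1, h2⟩, ⟨h2, h1⟩]
    have k1 : 𝒢.pathHom h.1 (𝒢.pathHom q root) = 𝒢.pathHom (q * 𝒢.ofEdge e) root :=
      congrArg Subtype.val key.1
    have k2 : 𝒢.pathHom h.1 (𝒢.pathHom (q * 𝒢.ofEdge e) root) = 𝒢.pathHom q root :=
      congrArg Subtype.val key.2
    obtain ⟨g, hg⟩ := (((hq.comp (.edge e)).inv.comp h.2).comp hq).exists_eq_ofVertex (by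
      rw [map_mul, map_mul, Equiv.Perm.mul_apply, Equiv.Perm.mul_apply, k1, map_inv,
        ← Equiv.Perm.mul_apply, inv_mul_cancel, Equiv.Perm.one_apply])
    have hh : h.1 = q * (𝒢.ofEdge e * 𝒢.ofVertex _ g) * q⁻¹ := by
      rw [← hg]
      group
    rw [hh, ← Equiv.Perm.mul_apply, ← map_mul, ← mul_assoc, inv_mul_cancel_right, mul_assoc q,
      map_mul _ q, Equiv.Perm.mul_apply] at k2
    have k3 := congrArg (fun w => w.1.length) ((𝒢.pathHom q).injective k2)
    have e1 : (𝒢.pathHom (𝒢.ofEdge e) root).1 = [triv 𝒢.edgeMap (e, true)] :=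
      (𝒢.pathHom_letter (e, true) root).trans (push_nil _)
    have e2 : ∀ w, (𝒢.pathHom (𝒢.ofEdge e) w).1 = push (e, true) w.1 :=
      𝒢.pathHom_letter (e, true)
    rw [map_mul, map_mul, Equiv.Perm.mul_apply, Equiv.Perm.mul_apply, e2, pathHom_ofVertex, e1,
      act_cons, push_of_head?_ne] at k3
    · simp [root] at k3
    · intro hne
      rw [List.head?_cons, Option.some.injEq] at hne
      exact absurd (congrArg (fun s => s.1.2) hne) (by simp [triv, opp])

end GraphOfGroups

/-! ### The gap theorem for graphs of groups -/

theorem mainTheorem4 (𝒢 : GraphOfGroups.{u, v, w, x}) (a : 𝒢.V) (D : ℕ)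
    (hBCMS : ∀ (e : 𝒢.E) (p : 𝒢.PathGroup) (hp : 𝒢.IsPath a (𝒢.tgt e) p),
      IsBCMS D (𝒢.edgeEmbedding e p hp).range)
    (c : IntegralChain (𝒢.fundamentalGroup a)) :
    (∃ c' : IntegralChain (𝒢.fundamentalGroup a),
        ChainEquiv c.toReal c'.toReal ∧ ∀ g ∈ c'.support, 𝒢.InVertexGroup g) ∨
      1 / (12 * ((D : ℝ≥0∞) + 2)) ≤ scl c := by
  have hB : ∀ y z, (𝒢.tree a).Adj y z → IsBCMS D
      (MulAction.stabilizer (𝒢.fundamentalGroup a) y ⊓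
        MulAction.stabilizer (𝒢.fundamentalGroup a) z) := fun y z hyz => by
    obtain ⟨e, q, hq, ⟨rfl, rfl⟩ | ⟨rfl, rfl⟩⟩ := GraphOfGroups.exists_edge_of_adj hyz
    · rw [GraphOfGroups.stabilizer_edge]
      exact hBCMS _ _ _
    · rw [inf_comm, GraphOfGroups.stabilizer_edge]
      exact hBCMS _ _ _
  rcases (GraphOfGroups.isTreeAction a).mem_chainSpan_or_le_scl hB c with h | h
  · left
    obtain ⟨c', hc', hsupp⟩ := exists_integralChain_of_mem_chainSpan h
    refine ⟨c', (Submodule.Quotient.eq _).1 hc'.symm, fun g hg => ?_⟩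
    obtain ⟨⟨_, b, p, hp, rfl⟩, hy⟩ := hsupp g hg
    obtain ⟨k, hk⟩ := GraphOfGroups.exists_of_smul_treeVertex_eq hp hy
    exact ⟨b, p, hp, k, Subtype.ext hk.symm⟩
  · right
    refine le_trans (le_of_eq ?_) h
    rw [ENNReal.ofReal_div_of_pos (by positivity), ENNReal.ofReal_one,
      ENNReal.ofReal_mul (by norm_num), ENNReal.ofReal_natCast, ENNReal.ofReal_ofNat]
    push_cast
    rfl
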